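/- Let $\{0,1\}^d$ carry the Hamming distance $D$, let $D(x,S)=\min_{p\in S}D(x,p)$, let $B(R,d)$ be the number of points of $\{0,1\}^d$ within distance $R$ of a fixed point, and let $\log=\log_2$. For $r\ge 0$, $c\ge 1$, $\varepsilon\in[0,1]$, an $(r,c,\varepsilon)$-distance sensitive approximate membership filter with point-wise error, for sets of $n$ points of $\{0,1\}^d$, using $s$ bits, is a randomized data structure that represents every $S\subseteq\{0,1\}^d$ with $|S|=n$ by a memory content in $\{0,1\}^s$ and answers each query $q\in\{0,1\}^d$ from this content; construction and queries share a source of randomness, which is not counted as space and whose distribution does not depend on $S$. For every such $S$ and every $q$ it must answer "Yes" always if $D(q,S)\le r$, and "No" with probability at least $1-\varepsilon$ (over the random choices) if $D(q,S)>cr$. **Theorem.** (1) There is a universal constant $C$ such that for all $d$, all $n\ge1$, and all real $r\ge 0$, $c>1$, $0<\varepsilon\le 1$ (with $\varepsilon\le 1/2$ if $n=1$) there is such a filter using at most $$C\,n\left(\frac{r}{c-1}+\left(\frac{c}{c-1}\right)^2\log\frac n\varepsilon\right)$$ bits; if $c\ge 2$, the same filter uses at most $C\,n\left(\frac rc+\log\frac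 n\varepsilon\right)$ bits. (2) For $c\ge2$ this is optimal up to constant factors when $r/c\ge\log(n/\varepsilon)$ or $\varepsilon\le 1/n^{1+o(1)}$, provided that $n\,B(cr,d)/2^d<\varepsilon<1/4$. Precisely: there is a universal constant $\kappa>0$ such that for all $d$, $n\ge1$, $r\ge0$, $c\ge2$, $\varepsilon$ with $n\,B(cr,d)/2^d<\varepsilon<1/4$ and $r/c\ge\log(n/\varepsilon)$, every such filter uses at least $\kappa\,n\left(\frac rc+\log\frac n\varepsilon\right)$ bits; and for every function $h:\mathbb N\to\mathbb R$ with $h(n)\to0$ as $n\to\infty$ there is a constant $\kappa_h>0$ such that the same lower bound, with $\kappa_h$ in place of $\kappa$, holds whenever $d$, $n\ge1$, $r\ge0$, $c\ge2$ and $n\,B(cr,d)/2^d<\varepsilon<1/4$ and $\varepsilon\le 1/n^{1+h(n)}$. -/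

import Mathlib

open Filter Topology

/-- The Hamming cube `{0,1}^d`; its distance is Mathlib's `hammingDist`. -/
abbrev Cube (d : ℕ) : Type := Fin d → Bool

/-- The Hamming ball of (real) radius `R` around `q` in `{0,1}^d`. -/
noncomputable def hammingBall {d : ℕ} (q : Cube d) (R : ℝ) : Finset (Cube d) :=
  Finset.univ.filter fun p => (hammingDist p q : ℝ) ≤ R

/-- The size `B(R, d)` of a Hamming ball of radius `R` in `{0,1}^d` (it does not depend on the
center; we use the ball around the origin). -/
noncomputable def ballSize (R : ℝ) (d : ℕ) : ℕ :=
  (hammingBall (fun _ : Fin d => false) R).card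

/-- `Q_near = {x : D(x, S) ≤ r}`, where `D(x, S)` is the minimum distance from `x` to `S`. -/
def Qnear {d : ℕ} (S : Finset (Cube d)) (r : ℝ) : Set (Cube d) :=
  {x | ∃ p ∈ S, (hammingDist x p : ℝ) ≤ r}

/-- `Q_far = {x : D(x, S) > c r}`. -/
def Qfar {d : ℕ} (S : Finset (Cube d)) (r c : ℝ) : Set (Cube d) :=
  {x | ∀ p ∈ S, c * r < (hammingDist x p : ℝ)}

/-- A data structure with `s` bits of memory for sets of points of `{0,1}^d`, for one fixed outcome
of the random choices: `store S` is the memory content that represents `S`, and `query` answers a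
query point (`true` is 'Yes', `false` is 'No') from the memory content alone. -/
structure DetFilter (d s : ℕ) where
  /-- The memory content representing a set. -/
  store : Finset (Cube d) → (Fin s → Bool)
  /-- The answer to a query, as a function of the memory content and the query point. -/
  query : (Fin s → Bool) → Cube d → Bool

/-- A randomized data structure with `s` bits of memory: a probability distribution over
deterministic ones. The construction and the query algorithm share their source of randomness,
which is not part of the memory. The distribution does not depend on the stored set. -/
abbrev RandFilter (d s : ℕ) : Type := PMF (DetFilter d s)

/-- `F` is an `(r, c, ε)`-distance sensitive approximate membership filter with point-wise error
for all sets `S ⊆ {0,1}^d` of `n` points: near queries are always answered 'Yes' (there are no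
false negatives, whatever the random choices), and each far query is answered 'No' with
probability at least `1 - ε` over the random choices. -/
def RandFilter.HasPointwiseError {d s : ℕ} (F : RandFilter d s) (n : ℕ) (r c ε : ℝ) : Prop :=
  ∀ S : Finset (Cube d), S.card = n →
    (∀ q ∈ Qnear S r, ∀ f ∈ F.support, f.query (f.store S) q = true) ∧
    (∀ q ∈ Qfar S r c,
      ENNReal.ofReal (1 - ε) ≤ F.toOuterMeasure {f | f.query (f.store S) q = false})

/-! Upper bound. It suffices to sketch one point with error `ε / n`: a filter stores the `n`
sketches side by side and answers 'Yes' if some sketch accepts, so the errors add up and near points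
are never lost. Both sketches repeat every coordinate `k` times and hash the copies into `m`
buckets.

For bounded `c`, each bucket keeps a parity. The distance of two sketches is the number of buckets
receiving an odd number of differing copies; it never exceeds `k` times the distance of the points,
and for far points it falls short of that only through collisions, which are rare when `m` is large
compared with the number of differing copies (`hasPointSketch_parity`).

For large `c`, this many buckets would be wasteful. Each bucket instead forms a randomly signed sum,
wraps it with a random shift around a circle of `2 * w` arcs and keeps one bit, the half circle it
falls in. Near points move the angles by a small total amount, deterministically. For far points the
sums spread around the circle: the expected products of their cosines factor over the coordinates,
and so a constant penalty per bucket is typical (`hasPointSketch_signedSum`). Then `m` of order `r /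
c + log (n / ε)` suffices.

Lower bound. Since the neighbourhood of `S` fills less than a fraction `ε` of the cube, the 'Yes'
set has expected density at most `2 * ε`. Some fixed outcome of the randomness therefore gives most
sets a 'Yes' set of density at most `√(2 * ε)`. A set stored under a memory content consists of
points whose whole `r`-ball lies in the 'Yes' set of that content. If such points have density at
most `ξ`, one content serves at most a fraction `ξ ^ n` of all sets, so `2 ^ s * ξ ^ n` is bounded
below (`one_sub_le_two_pow_mul_pow`). Taking `ξ` to be the density of the 'Yes' set gives `n * log
(1 / ε)`; isoperimetry in the cube gives `ξ = 4 * exp (-r ^ 2 / d)`, hence `n * r ^ 2 / d`.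
Restricting to a subcube of dimension `O(c * r)` turns the latter into `n * r / c`. -/

/-! ### Filters from sketches of single points -/

/-- A randomized sketch of a single point by `m` bits: queries within distance `r` of the sketched
point are always accepted, queries at distance more than `c * r` are accepted with probability at
most `δ`. -/
def HasPointSketch (d m : ℕ) (r c δ : ℝ) : Prop :=
  ∃ (Ω : Type) (_ : Fintype Ω) (_ : Nonempty Ω) (enc : Ω → Cube d → (Fin m → Bool))
    (ans : Ω → (Fin m → Bool) → Cube d → Bool),
    (∀ ω x q, (hammingDist q x : ℝ) ≤ r → ans ω (enc ω x) q = true) ∧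
    (∀ x q, c * r < (hammingDist q x : ℝ) →
      ((Finset.univ.filter fun ω => ans ω (enc ω x) q = true).card : ℝ) ≤ δ * Fintype.card Ω)

/-- Storing the sketches of the points of the set one after the other. -/
theorem HasPointSketch.exists_filter {d m n : ℕ} {r c ε δ : ℝ} (H : HasPointSketch d m r c δ)
    (hδ : n * δ ≤ ε) :
    ∃ F : RandFilter d (n * m), RandFilter.HasPointwiseError F n r c ε := by
  classical
  obtain ⟨Ω, _, _, enc, ans, near, far⟩ := H
  -- The default point is never read when `S` has `n` elements.
  let pt : Finset (Cube d) → Fin n → Cube d := fun S i => S.toList.getD i (fun _ => false)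
  let build : Ω → DetFilter d (n * m) := fun ω =>
    { store := fun S t => enc ω (pt S (finProdFinEquiv.symm t).1) (finProdFinEquiv.symm t).2
      query := fun mem q =>
        decide (∃ i : Fin n, ans ω (fun j => mem (finProdFinEquiv (i, j))) q = true) }
  have hq : ∀ ω S q, (build ω).query ((build ω).store S) q = true ↔
      ∃ i : Fin n, ans ω (enc ω (pt S i)) q = true := by
    intro ω S q
    simp [build]
  refine ⟨(PMF.uniformOfFintype Ω).map build, fun S hS => ⟨?_, ?_⟩⟩
  · rintro q ⟨p, hp, hpr⟩ f hf
    rw [PMF.mem_support_map_iff] at hf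
    obtain ⟨ω, -, rfl⟩ := hf
    rw [hq]
    obtain ⟨i, hi, hip⟩ := List.mem_iff_getElem.1 (Finset.mem_toList.2 hp)
    have hi' : i < n := by simpa [hS] using hi
    refine ⟨⟨i, hi'⟩, ?_⟩
    have : pt S ⟨i, hi'⟩ = p := by simp only [pt]; rw [List.getD_eq_getElem _ _ hi, hip]
    rw [this]
    exact near ω p q hpr
  · intro q hfar
    rw [PMF.toOuterMeasure_map_apply, PMF.toOuterMeasure_uniformOfFintype_apply]
    have hpt : ∀ i : Fin n, pt S i ∈ S := by
      intro i
      have hi : (i : ℕ) < S.toList.length := by simp [hS]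
      simp only [pt]
      rw [List.getD_eq_getElem _ _ hi]
      exact Finset.mem_toList.1 (List.getElem_mem hi)
    set G : Finset Ω := Finset.univ.filter fun ω => (build ω).query ((build ω).store S) q = false
      with hG
    have hGc : Fintype.card (build ⁻¹' {f | f.query (f.store S) q = false} : Set Ω) = G.card := by
      rw [Fintype.card_subtype, hG]
      congr 1
      ext ω
      simp
    have hbad : ((Finset.univ \ G).card : ℝ) ≤ n * (δ * Fintype.card Ω) := by
      have hsub : Finset.univ \ G ⊆ Finset.univ.biUnion fun i : Fin n =>
          Finset.univ.filter fun ω => ans ω (enc ω (pt S i)) q = true := by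
        intro ω hω
        have hω' : (build ω).query ((build ω).store S) q = true := by
          simpa [hG] using hω
        simpa using (hq ω S q).1 hω'
      have h1 := (Finset.card_le_card hsub).trans Finset.card_biUnion_le
      calc ((Finset.univ \ G).card : ℝ)
          ≤ ∑ i : Fin n, ((Finset.univ.filter fun ω =>
              ans ω (enc ω (pt S i)) q = true).card : ℝ) := by exact_mod_cast h1
        _ ≤ ∑ _i : Fin n, δ * Fintype.card Ω :=
            Finset.sum_le_sum fun i _ => far _ _ (hfar _ (hpt i))
        _ = n * (δ * Fintype.card Ω) := by simp
    have hcard : ((Finset.univ \ G).card : ℝ) = Fintype.card Ω - G.card := by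
      rw [Finset.card_sdiff_of_subset (Finset.subset_univ _), Finset.card_univ,
        Nat.cast_sub (Finset.card_le_univ _)]
    have hpos : (0 : ℝ) < Fintype.card Ω := by exact_mod_cast Fintype.card_pos
    have hge : 1 - ε ≤ (G.card : ℝ) / Fintype.card Ω := by
      rw [le_div_iff₀ hpos]
      have : n * δ * Fintype.card Ω ≤ ε * Fintype.card Ω :=
        mul_le_mul_of_nonneg_right hδ hpos.le
      linarith
    rw [hGc]
    calc ENNReal.ofReal (1 - ε) ≤ ENNReal.ofReal ((G.card : ℝ) / Fintype.card Ω) :=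
          ENNReal.ofReal_le_ofReal hge
      _ = (G.card : ENNReal) / Fintype.card Ω := by
          rw [ENNReal.ofReal_div_of_pos hpos]
          simp

/-! ### The parity sketch -/

/-- Resampling the value of a random function at one argument. -/
theorem sum_resample {α β : Type*} [Fintype α] [DecidableEq α] [Fintype β]
    (a : α) (Φ : (α → β) → ℝ) :
    ∑ h : α → β, ∑ b : β, Φ (Function.update h a b) = Fintype.card β * ∑ h, Φ h := by
  have h1 : ∑ h : α → β, ∑ b : β, Φ (Function.update h a b) =
      ∑ x : (α → β) × β, Φ (Function.update x.1 a x.2) := by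
    rw [Fintype.sum_prod_type]
  have h2 : ∑ x : (α → β) × β, Φ (Function.update x.1 a x.2) = ∑ x : (α → β) × β, Φ x.1 := by
    -- Exchanging the new value `b` with the old value `h a` is an involution.
    refine Finset.sum_nbij' (fun x => (Function.update x.1 a x.2, x.1 a))
      (fun x => (Function.update x.1 a x.2, x.1 a)) ?_ ?_ ?_ ?_ ?_ <;> simp
  rw [h1, h2, Fintype.sum_prod_type]
  simp [Finset.mul_sum]

/-- The exponential moment method on a finite probability space. -/
theorem card_filter_le_exp_mul_sum {Ω : Type*} [Fintype Ω] (Z : Ω → ℝ) (a : ℝ)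
    [DecidablePred fun ω => Z ω ≤ a] :
    ((Finset.univ.filter fun ω => Z ω ≤ a).card : ℝ) ≤
      Real.exp a * ∑ ω, Real.exp (-Z ω) := by
  rw [Finset.card_eq_sum_ones, Nat.cast_sum, Finset.sum_filter, Finset.mul_sum]
  refine Finset.sum_le_sum fun ω _ => ?_
  rw [← Real.exp_add]
  split_ifs with h
  · simp only [Nat.cast_one, Real.one_le_exp_iff]
    linarith
  · positivity

/-- Coordinates in which `q` and `x` differ, each repeated `k` times. -/
theorem card_filter_ne_fst {d k : ℕ} (q x : Cube d) :
    (Finset.univ.filter fun a : Fin d × Fin k => q a.1 ≠ x a.1).card = k * hammingDist q x := by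
  have : (Finset.univ.filter fun a : Fin d × Fin k => q a.1 ≠ x a.1) =
      (Finset.univ.filter fun i => q i ≠ x i) ×ˢ (Finset.univ : Finset (Fin k)) := by
    ext a; simp
  rw [this, Finset.card_product]
  simp [hammingDist, mul_comm]

/-- The buckets that receive an odd number of elements of `A`. -/
def oddBuckets {α : Type*} [DecidableEq α] {m : ℕ} (h : α → Fin m) (A : Finset α) :
    Finset (Fin m) :=
  Finset.univ.filter fun j => Odd (A.filter fun a => h a = j).card

theorem card_fiber_update_insert {α : Type*} [DecidableEq α] {m : ℕ} (h : α → Fin m)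
    {A : Finset α} {a : α} (ha : a ∉ A) (b j : Fin m) :
    ((insert a A).filter fun x => Function.update h a b x = j).card =
      (A.filter fun x => h x = j).card + if b = j then 1 else 0 := by
  have : (A.filter fun x => Function.update h a b x = j) = A.filter fun x => h x = j := by
    refine Finset.filter_congr fun x hx => ?_
    rw [Function.update_of_ne (by rintro rfl; exact ha hx)]
  rw [Finset.filter_insert, this]
  split_ifs with h1 h2 h2
  · rw [Finset.card_insert_of_notMem (by simp [ha])]
  · simp at h1; exact absurd h1 h2
  · simp at h1; exact absurd h2 h1
  · simp

theorem oddBuckets_update_insert {α : Type*} [DecidableEq α] {m : ℕ} (h : α → Fin m)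
    {A : Finset α} {a : α} (ha : a ∉ A) (b : Fin m) :
    oddBuckets (Function.update h a b) (insert a A) =
      if b ∈ oddBuckets h A then (oddBuckets h A).erase b else insert b (oddBuckets h A) := by
  ext j
  have := card_fiber_update_insert h ha b j
  by_cases hj : b = j
  · subst hj
    by_cases hb : Odd (A.filter fun x => h x = b).card <;>
      simp [oddBuckets, this, hb, Nat.odd_add_one]
  · have hj' : j ≠ b := fun e => hj e.symm
    split_ifs <;> simp [oddBuckets, this, hj, hj']

theorem card_oddBuckets_le {α : Type*} [DecidableEq α] {m : ℕ} (h : α → Fin m)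
    (A : Finset α) : (oddBuckets h A).card ≤ A.card := by
  rw [Finset.card_eq_sum_card_fiberwise (f := h) (t := Finset.univ) (fun _ _ => by simp),
    Finset.card_eq_sum_ones, oddBuckets, Finset.sum_filter]
  refine Finset.sum_le_sum fun j _ => ?_
  split_ifs with hj
  · exact hj.pos
  · exact Nat.zero_le _

/-- Resample the bucket of `a`: it hits an odd bucket, lowering the count, with probability `|O| /
m`, and otherwise raises the count by one. If `|O| ≤ τ * m`, the moment shrinks by at least the
factor `e⁻¹ * (1 + 9 * τ)`, as `e ≤ 9 * e⁻¹`; if `|O| > τ * m`, the new term is already at most `exp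
(1 - τ * m)`. -/
theorem sum_exp_oddBuckets_insert {α : Type*} [Fintype α] [DecidableEq α] {m : ℕ} (hm : 0 < m)
    {A : Finset α} {a : α} (ha : a ∉ A) {τ : ℝ} (hτ : 0 ≤ τ) :
    ∑ h : α → Fin m, Real.exp (-((oddBuckets h (insert a A)).card : ℝ)) ≤
      Real.exp (-1 + 9 * τ) * (∑ h : α → Fin m, Real.exp (-((oddBuckets h A).card : ℝ))) +
        Fintype.card (α → Fin m) * Real.exp (1 - τ * m) := by
  have hm' : (0 : ℝ) < m := by exact_mod_cast hm
  have h1 := sum_resample (α := α) (β := Fin m) a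
    (fun h => Real.exp (-((oddBuckets h (insert a A)).card : ℝ)))
  rw [Fintype.card_fin] at h1
  have h2 : ∀ h : α → Fin m,
      ∑ b, Real.exp (-((oddBuckets (Function.update h a b) (insert a A)).card : ℝ)) ≤
        m * (Real.exp (-1 + 9 * τ) * Real.exp (-((oddBuckets h A).card : ℝ)) +
          Real.exp (1 - τ * m)) := by
    intro h
    set O := oddBuckets h A with hO
    have hle : (O.card : ℝ) ≤ m := by
      have := Finset.card_le_univ O
      rw [Fintype.card_fin] at this
      exact_mod_cast this
    have e1 : ∀ b, Real.exp (-((oddBuckets (Function.update h a b) (insert a A)).card : ℝ)) =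
        Real.exp (-1) * Real.exp (-(O.card : ℝ)) + if b ∈ O then
          (Real.exp 1 - Real.exp (-1)) * Real.exp (-(O.card : ℝ)) else 0 := by
      intro b
      rw [oddBuckets_update_insert h ha, ← hO]
      split_ifs with hb
      · rw [Finset.card_erase_of_mem hb, Nat.cast_sub (Finset.card_pos.2 ⟨b, hb⟩), sub_mul,
          ← Real.exp_add, ← Real.exp_add, Nat.cast_one]
        ring_nf
      · rw [Finset.card_insert_of_notMem hb, add_zero, ← Real.exp_add]
        push_cast
        ring_nf
    simp_rw [e1]
    rw [Finset.sum_add_distrib, Finset.sum_const, Finset.card_univ, Fintype.card_fin,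
      ← Finset.sum_filter, Finset.filter_mem_eq_inter, Finset.univ_inter, Finset.sum_const,
      nsmul_eq_mul, nsmul_eq_mul]
    have hE := Real.exp_pos (-(O.card : ℝ))
    have hi := Real.exp_pos (-1 : ℝ)
    have he := Real.exp_one_lt_d9
    have hprod : Real.exp (-1) * Real.exp 1 = 1 := by rw [← Real.exp_add]; simp
    by_cases hc : (O.card : ℝ) ≤ τ * m
    · have : Real.exp (-1) * (1 + 9 * τ) ≤ Real.exp (-1 + 9 * τ) := by
        rw [Real.exp_add]
        have := Real.add_one_le_exp (9 * τ)
        gcongr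
        linarith
      have h9 : Real.exp 1 ≤ 9 * Real.exp (-1) := by nlinarith
      have k1 : (O.card : ℝ) * ((Real.exp 1 - Real.exp (-1)) * Real.exp (-(O.card : ℝ))) ≤
          (τ * m) * ((9 * Real.exp (-1)) * Real.exp (-(O.card : ℝ))) := by
        have : Real.exp (-1) ≤ Real.exp 1 := Real.exp_le_exp.2 (by norm_num)
        apply mul_le_mul hc _ _ (by positivity)
        · gcongr; linarith
        · exact mul_nonneg (by linarith) hE.le
      have k2 : (m : ℝ) * ((Real.exp (-1) * (1 + 9 * τ)) * Real.exp (-(O.card : ℝ))) ≤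
          m * (Real.exp (-1 + 9 * τ) * Real.exp (-(O.card : ℝ))) := by gcongr
      have k3 : 0 ≤ (m : ℝ) * Real.exp (1 - τ * m) := by positivity
      nlinarith
    · have k0 : Real.exp 1 * Real.exp (-(O.card : ℝ)) ≤ Real.exp (1 - τ * m) := by
        rw [← Real.exp_add]
        apply Real.exp_le_exp.2
        linarith
      have k1 : (O.card : ℝ) * ((Real.exp 1 - Real.exp (-1)) * Real.exp (-(O.card : ℝ))) ≤
          m * ((Real.exp 1 - Real.exp (-1)) * Real.exp (-(O.card : ℝ))) := by
        have : Real.exp (-1) ≤ Real.exp 1 := Real.exp_le_exp.2 (by norm_num)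
        apply mul_le_mul_of_nonneg_right hle
        exact mul_nonneg (by linarith) hE.le
      have k2 : (m : ℝ) * (Real.exp 1 * Real.exp (-(O.card : ℝ))) ≤ m * Real.exp (1 - τ * m) := by
        gcongr
      have k3 : 0 ≤ (m : ℝ) * (Real.exp (-1 + 9 * τ) * Real.exp (-(O.card : ℝ))) := by positivity
      nlinarith
  have h3 := Finset.sum_le_sum fun h (_ : h ∈ (Finset.univ : Finset (α → Fin m))) => h2 h
  rw [h1, ← Finset.mul_sum, Finset.sum_add_distrib, ← Finset.mul_sum, Finset.sum_const,
    Finset.card_univ, nsmul_eq_mul] at h3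
  exact le_of_mul_le_mul_left h3 hm'

/-- Iterating the recursion, the error terms form a geometric series of ratio at most `exp (-1 / 2)
≤ 2 / 3`, whence the factor `3`. -/
theorem sum_exp_oddBuckets_le {α : Type*} [Fintype α] [DecidableEq α] {m : ℕ} (hm : 0 < m)
    (A : Finset α) {τ : ℝ} (hτ : 0 ≤ τ) (hτ' : τ ≤ 1 / 18) :
    ∑ h : α → Fin m, Real.exp (-((oddBuckets h A).card : ℝ)) ≤
      Fintype.card (α → Fin m) *
        (Real.exp (-1 + 9 * τ) ^ A.card + 3 * Real.exp (1 - τ * m)) := by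
  have hq : Real.exp (-1 + 9 * τ) ≤ 2 / 3 := by
    have h1 : Real.exp (-1 + 9 * τ) ≤ Real.exp (-(1 / 2)) := Real.exp_le_exp.2 (by linarith)
    have h2 := Real.add_one_le_exp (1 / 2 : ℝ)
    have h3 : Real.exp (-(1 / 2) : ℝ) * Real.exp (1 / 2) = 1 := by rw [← Real.exp_add]; simp
    nlinarith [Real.exp_pos (-(1 / 2) : ℝ)]
  have hβ := Real.exp_pos (1 - τ * m)
  have hc : (0 : ℝ) ≤ Fintype.card (α → Fin m) := Nat.cast_nonneg _
  induction A using Finset.induction_on with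
  | empty =>
    simp only [oddBuckets, Finset.filter_empty, Finset.card_empty, pow_zero]
    simp only [Nat.not_odd_zero, Finset.filter_false, Finset.card_empty, Nat.cast_zero, neg_zero,
      Real.exp_zero, Finset.sum_const, Finset.card_univ, nsmul_eq_mul, mul_one]
    nlinarith
  | insert a A ha ih =>
    refine (sum_exp_oddBuckets_insert hm ha hτ).trans ?_
    rw [Finset.card_insert_of_notMem ha, pow_succ]
    have hq0 := Real.exp_pos (-1 + 9 * τ)
    have := mul_le_mul_of_nonneg_left ih hq0.le
    have h2 : Real.exp (-1 + 9 * τ) * (Fintype.card (α → Fin m) * Real.exp (1 - τ * m)) ≤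
      2 / 3 * (Fintype.card (α → Fin m) * Real.exp (1 - τ * m)) := by gcongr
    nlinarith

/-- Parities of the buckets of a random partition of the coordinates, each repeated `k` times. -/
theorem hasPointSketch_parity {d m k : ℕ} {r c δ D₀ θ : ℝ} (hm : 0 < m) (hθ : 0 < θ) (hθ1 : θ ≤ 1)
    (hD₀ : 0 ≤ D₀) (hr : r ≤ (1 - θ) * D₀)
    (hfar : ∀ t : ℕ, c * r < t → D₀ ≤ t) (hmk : 36 * (k * D₀) ≤ θ * m)
    (hδ : 10 * Real.exp (-(θ * (k * D₀) / 2)) ≤ δ) : HasPointSketch d m r c δ := by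
  classical
  have : NeZero m := ⟨hm.ne'⟩
  let supp : Cube d → Finset (Fin d × Fin k) := fun x => Finset.univ.filter fun a => x a.1 = true
  have hdist : ∀ (h : Fin d × Fin k → Fin m) (q x : Cube d),
      hammingDist (fun j => decide (j ∈ oddBuckets h (supp x)))
        (fun j => decide (j ∈ oddBuckets h (supp q))) =
      (oddBuckets h (Finset.univ.filter fun a : Fin d × Fin k => q a.1 ≠ x a.1)).card := by
    intro h q x
    unfold hammingDist
    congr 1
    ext j
    -- The two supports together count a differing coordinate once and a common one twice, so modulo
    -- 2 only the differing ones remain.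
    have e1 : ((supp x).filter fun a => h a = j).card + ((supp q).filter fun a => h a = j).card =
        ((Finset.univ.filter fun a : Fin d × Fin k => q a.1 ≠ x a.1).filter
          fun a => h a = j).card + 2 * (((supp x ∩ supp q)).filter fun a => h a = j).card := by
      simp only [supp, Finset.filter_filter, ← Finset.filter_and, Finset.card_filter,
        Finset.mul_sum, ← Finset.sum_add_distrib]
      refine Finset.sum_congr rfl fun a _ => ?_
      cases q a.1 <;> cases x a.1 <;> by_cases hj : h a = j <;> simp [hj]
    simp only [oddBuckets, Finset.mem_filter, Finset.mem_univ, true_and, ne_eq, decide_eq_decide]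
    have e2 := congrArg Odd e1
    rw [eq_iff_iff, Nat.odd_add, Nat.odd_add, ← Nat.not_odd_iff_even, ← Nat.not_odd_iff_even] at e2
    have e3 : ¬ Odd (2 * (((supp x ∩ supp q)).filter fun a => h a = j).card) := by
      rw [Nat.not_odd_iff_even]; exact even_two_mul _
    tauto
  refine ⟨Fin d × Fin k → Fin m, inferInstance, inferInstance,
    fun h x j => decide (j ∈ oddBuckets h (supp x)),
    fun h mem q => decide ((hammingDist mem (fun j => decide (j ∈ oddBuckets h (supp q))) : ℝ) ≤
      k * r), ?_, ?_⟩
  · intro h x q hqx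
    rw [decide_eq_true_iff, hdist]
    calc ((oddBuckets h _).card : ℝ) ≤ ((Finset.univ.filter
          fun a : Fin d × Fin k => q a.1 ≠ x a.1).card : ℝ) := by
          exact_mod_cast card_oddBuckets_le _ _
      _ = k * hammingDist q x := by rw [card_filter_ne_fst]; push_cast; rfl
      _ ≤ k * r := by gcongr
  · intro x q hqx
    simp only [decide_eq_true_iff, hdist]
    refine (card_filter_le_exp_mul_sum _ _).trans ?_
    have hD : D₀ ≤ hammingDist q x := hfar _ hqx
    have hK : (k : ℝ) * D₀ ≤ k * hammingDist q x := by gcongr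
    -- With `τ = θ / 18` the decay rate is `1 - θ / 2`, against an acceptance threshold of at most
    -- `(1 - θ) * K`: half of the gap survives. The bound on `m` gives `τ * m ≥ 2 * K`, which makes
    -- the collision term as small; the prefactor is `1 + 3 * 3 = 10`.
    have hs := sum_exp_oddBuckets_le hm
      (Finset.univ.filter fun a : Fin d × Fin k => q a.1 ≠ x a.1) (τ := θ / 18)
      (by positivity) (by linarith)
    rw [card_filter_ne_fst] at hs
    set K : ℝ := k * D₀ with hKdef
    have hK0 : 0 ≤ K := by positivity
    have b1 : Real.exp (-1 + 9 * (θ / 18)) ^ (k * hammingDist q x) ≤ Real.exp (-(1 - θ / 2) * K) := by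
      rw [← Real.exp_nat_mul]
      apply Real.exp_le_exp.2
      push_cast
      nlinarith
    have hmul : (k : ℝ) * r ≤ (1 - θ) * K := by
      have := mul_le_mul_of_nonneg_left hr (Nat.cast_nonneg (α := ℝ) k)
      rw [hKdef]
      linarith
    have c1 : Real.exp (k * r) * Real.exp (-(1 - θ / 2) * K) ≤ Real.exp (-(θ * K / 2)) := by
      rw [← Real.exp_add]
      apply Real.exp_le_exp.2
      linarith
    have c2 : Real.exp (k * r) * Real.exp (1 - θ / 18 * m) ≤ 3 * Real.exp (-(θ * K / 2)) := by
      have h3 : Real.exp 1 ≤ 3 := by linarith [Real.exp_one_lt_d9]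
      calc Real.exp (k * r) * Real.exp (1 - θ / 18 * m) ≤ Real.exp 1 * Real.exp (-(θ * K / 2)) := by
            rw [← Real.exp_add, ← Real.exp_add]
            apply Real.exp_le_exp.2
            nlinarith
        _ ≤ _ := by gcongr
    have hN : (0 : ℝ) ≤ Fintype.card (Fin d × Fin k → Fin m) := Nat.cast_nonneg _
    have he := Real.exp_pos (k * r)
    calc Real.exp (k * r) * _ ≤ Real.exp (k * r) * (Fintype.card (Fin d × Fin k → Fin m) *
          (Real.exp (-(1 - θ / 2) * K) + 3 * Real.exp (1 - θ / 18 * m))) := by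
          refine mul_le_mul_of_nonneg_left (hs.trans ?_) he.le
          gcongr
      _ = Fintype.card (Fin d × Fin k → Fin m) * (Real.exp (k * r) * Real.exp (-(1 - θ / 2) * K) +
          3 * (Real.exp (k * r) * Real.exp (1 - θ / 18 * m))) := by ring
      _ ≤ Fintype.card (Fin d × Fin k → Fin m) * δ := by
          gcongr
          linarith
      _ = _ := by ring

/-! ### Cosine moments of random signed sums -/

/-- The signed sum of `v` over the elements of `A` in bucket `j`, for the assignment `h` of buckets
and signs. -/
def signedSum {α : Type*} {m : ℕ} (h : α → Fin m × Bool) (v : α → ℤ) (A : Finset α)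
    (j : Fin m) : ℤ :=
  ∑ a ∈ A, if (h a).1 = j then (if (h a).2 then v a else -v a) else 0

theorem signedSum_update_insert {α : Type*} [DecidableEq α] {m : ℕ} (h : α → Fin m × Bool)
    (v : α → ℤ) {A : Finset α} {a : α} (ha : a ∉ A) (b : Fin m × Bool) (j : Fin m) :
    signedSum (Function.update h a b) v (insert a A) j =
      signedSum h v A j + if b.1 = j then (if b.2 then v a else -v a) else 0 := by
  unfold signedSum
  rw [Finset.sum_insert ha, Function.update_self, add_comm]
  congr 1
  refine Finset.sum_congr rfl fun x hx => ?_
  rw [Function.update_of_ne (by rintro rfl; exact ha hx)]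

/-- Resample the bucket and sign of one element. If its bucket lies outside `T`, nothing changes; if
inside, averaging `cos (x ± y)` over the sign gives `cos x * cos y`. So each element contributes an
independent factor. -/
theorem sum_prod_cos_signedSum {α : Type*} [Fintype α] [DecidableEq α] {m : ℕ} (hm : 0 < m)
    (v : α → ℤ) (γ : ℝ) (T : Finset (Fin m)) (A : Finset α) :
    ∑ h : α → Fin m × Bool, ∏ j ∈ T, Real.cos (γ * signedSum h v A j) =
      Fintype.card (α → Fin m × Bool) *
        ∏ a ∈ A, (1 - (1 - Real.cos (γ * v a)) * (T.card / m)) := by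
  have hm' : (m : ℝ) ≠ 0 := by exact_mod_cast hm.ne'
  induction A using Finset.induction_on with
  | empty => simp [signedSum]
  | insert a A ha ih =>
    have h1 := sum_resample (α := α) (β := Fin m × Bool) a
      (fun h => ∏ j ∈ T, Real.cos (γ * signedSum h v (insert a A) j))
    have h2 : ∀ h : α → Fin m × Bool, ∑ b : Fin m × Bool,
        ∏ j ∈ T, Real.cos (γ * signedSum (Function.update h a b) v (insert a A) j) =
        2 * m * (1 - (1 - Real.cos (γ * v a)) * (T.card / m)) *
          ∏ j ∈ T, Real.cos (γ * signedSum h v A j) := by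
      intro h
      set P := ∏ j ∈ T, Real.cos (γ * signedSum h v A j) with hP
      have h3 : ∀ b : Fin m, ∑ s : Bool,
          ∏ j ∈ T, Real.cos (γ * signedSum (Function.update h a (b, s)) v (insert a A) j) =
          2 * P + if b ∈ T then 2 * (Real.cos (γ * v a) - 1) * P else 0 := by
        intro b
        simp_rw [signedSum_update_insert h v ha]
        split_ifs with hb
        · rw [Fintype.sum_bool, hP, ← Finset.mul_prod_erase T _ hb, ← Finset.mul_prod_erase T _ hb,
            ← Finset.mul_prod_erase T _ hb]
          have e : ∀ s : Bool, ∏ j ∈ T.erase b, Real.cos (γ * ((signedSum h v A j +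
              (if b = j then (if s then v a else -v a) else 0) : ℤ) : ℝ)) =
              ∏ j ∈ T.erase b, Real.cos (γ * signedSum h v A j) := by
            intro s
            refine Finset.prod_congr rfl fun j hj => ?_
            rw [if_neg (Finset.ne_of_mem_erase hj).symm, add_zero]
          have e1 := e true
          have e2 := e false
          simp only [if_true, Bool.false_eq_true, if_false] at e1 e2
          simp only [if_true, Bool.false_eq_true, if_false]
          rw [e1, e2]
          push_cast
          rw [mul_add, mul_add, Real.cos_add, Real.cos_add, mul_neg, Real.cos_neg, Real.sin_neg]
          ring
        · rw [Fintype.sum_bool, add_zero, two_mul]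
          congr 1 <;>
          · refine Finset.prod_congr rfl fun j hj => ?_
            rw [if_neg (by rintro rfl; exact hb hj), add_zero]
      rw [Fintype.sum_prod_type]
      simp_rw [h3]
      rw [Finset.sum_add_distrib, Finset.sum_const, Finset.card_univ, Fintype.card_fin,
        ← Finset.sum_filter, Finset.filter_mem_eq_inter, Finset.univ_inter, Finset.sum_const,
        nsmul_eq_mul, nsmul_eq_mul]
      field_simp
      ring
    simp_rw [h2] at h1
    rw [← Finset.mul_sum, ih, Fintype.card_prod, Fintype.card_fin, Fintype.card_bool] at h1
    rw [Finset.prod_insert ha]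
    have h4 : ((m * 2 : ℕ) : ℝ) ≠ 0 := by push_cast; positivity
    apply mul_left_cancel₀ h4
    rw [← h1]
    push_cast
    ring

/-- The bucket sums are dependent, but expanding the product over subsets `T` reduces to the exact
formula; each term is at most `E ^ T.card`, as for independent buckets, and the binomial sum closes
up again. -/
theorem sum_prod_affine_cos_signedSum_le {α : Type*} [Fintype α] [DecidableEq α] {m : ℕ}
    (hm : 0 < m) (v : α → ℤ) (γ : ℝ) (hγ : ∀ a, 0 ≤ Real.cos (γ * v a)) :
    ∑ h : α → Fin m × Bool, ∏ j, (1 / 8 * Real.cos (γ * signedSum h v Finset.univ j) + 7 / 8) ≤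
      Fintype.card (α → Fin m × Bool) *
        (1 / 8 * Real.exp (-((∑ a, (1 - Real.cos (γ * v a))) / m)) + 7 / 8) ^ m := by
  have hm' : (0 : ℝ) < m := by exact_mod_cast hm
  set E := Real.exp (-((∑ a, (1 - Real.cos (γ * v a))) / m)) with hE
  have key : ∀ T : Finset (Fin m),
      ∑ h : α → Fin m × Bool, ∏ j ∈ T, Real.cos (γ * signedSum h v Finset.univ j) ≤
        Fintype.card (α → Fin m × Bool) * E ^ T.card := by
    intro T
    rw [sum_prod_cos_signedSum hm]
    have hT : (T.card : ℝ) ≤ m := by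
      have := Finset.card_le_univ T
      rw [Fintype.card_fin] at this
      exact_mod_cast this
    have hT1 : (T.card : ℝ) / m ≤ 1 := (div_le_one hm').2 hT
    have hT0 : 0 ≤ (T.card : ℝ) / m := by positivity
    gcongr
    calc ∏ a, (1 - (1 - Real.cos (γ * v a)) * (T.card / m))
        ≤ ∏ a, Real.exp (-((1 - Real.cos (γ * v a)) * (T.card / m))) := by
          refine Finset.prod_le_prod (fun a _ => ?_) fun a _ => ?_
          · nlinarith [hγ a, Real.cos_le_one (γ * v a)]
          · have := Real.add_one_le_exp (-((1 - Real.cos (γ * v a)) * (T.card / m)))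
            linarith
      _ = E ^ T.card := by
          rw [← Real.exp_sum, hE, ← Real.exp_nat_mul, Finset.sum_neg_distrib, ← Finset.sum_mul]
          congr 1
          ring
  have e1 : ∀ x : Fin m → ℝ, ∏ j, (1 / 8 * x j + 7 / 8) =
      ∑ T : Finset (Fin m), (1 / 8 : ℝ) ^ T.card * (7 / 8) ^ Tᶜ.card * ∏ j ∈ T, x j := by
    intro x
    rw [Fintype.prod_add]
    refine Finset.sum_congr rfl fun T _ => ?_
    rw [Finset.prod_mul_distrib, Finset.prod_const, Finset.prod_const]
    ring
  simp_rw [e1]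
  rw [Finset.sum_comm]
  have e2 : (1 / 8 * E + 7 / 8) ^ m =
      ∑ T : Finset (Fin m), (1 / 8 : ℝ) ^ T.card * (7 / 8) ^ Tᶜ.card * E ^ T.card := by
    have := e1 fun _ => E
    simpa [Finset.prod_const] using this
  rw [e2, Finset.mul_sum]
  refine Finset.sum_le_sum fun T _ => ?_
  rw [← Finset.mul_sum]
  calc _ ≤ (1 / 8 : ℝ) ^ T.card * (7 / 8) ^ Tᶜ.card *
        (Fintype.card (α → Fin m × Bool) * E ^ T.card) := by gcongr; exact key T
    _ = _ := by ring

/-! ### One-bit quantization on the circle -/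

theorem sum_range_shift_of_periodic {N : ℕ} (F : ℤ → ℝ) (hF : ∀ i, F (i + N) = F i) (u : ℤ) :
    ∑ p ∈ Finset.range N, F (u + p) = ∑ p ∈ Finset.range N, F p := by
  have step : ∀ u : ℤ, ∑ p ∈ Finset.range N, F (u + 1 + p) = ∑ p ∈ Finset.range N, F (u + p) := by
    intro u
    have h1 := Finset.sum_range_succ (fun p : ℕ => F (u + p)) N
    have h2 := Finset.sum_range_succ' (fun p : ℕ => F (u + p)) N
    rw [h1, hF] at h2
    simp only [Nat.cast_zero, add_zero] at h2
    rw [add_right_cancel h2]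
    refine Finset.sum_congr rfl fun p _ => ?_
    push_cast
    ring_nf
  induction u using Int.induction_on with
  | zero => simp
  | succ i ih => rw [step, ih]
  | pred i ih =>
    rw [← ih, ← step (-i - 1)]
    simp

/-- The angle of the midpoint of the `u`-th of `2 * w` equal arcs of the circle. -/
noncomputable def arcAngle (w : ℕ) (u : ℤ) : ℝ := ((u : ℝ) + 1 / 2) * (Real.pi / w)

/-- The half of the circle in which the `u`-th arc lies. -/
noncomputable def arcSide (w : ℕ) (u : ℤ) : Bool := decide (0 ≤ Real.sin (arcAngle w u))

/-- A lower bound for the angle between the `u'`-th arc and the half circle of the `u`-th arc. -/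
noncomputable def arcGap (w : ℕ) (b : Bool) (u' : ℤ) : ℝ :=
  if b = arcSide w u' then 0 else |Real.sin (arcAngle w u')|

theorem arcGap_nonneg (w : ℕ) (b : Bool) (u' : ℤ) : 0 ≤ arcGap w b u' := by
  unfold arcGap; split_ifs <;> positivity

theorem arcGap_le_one (w : ℕ) (b : Bool) (u' : ℤ) : arcGap w b u' ≤ 1 := by
  unfold arcGap
  split_ifs
  · exact zero_le_one
  · exact Real.abs_sin_le_one _

/-- In opposite half circles the sines have opposite signs, so `|sin|` at `u'` is at most the
difference of the sines, and the sine is 1-Lipschitz. -/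
theorem arcGap_le (w : ℕ) (u u' : ℤ) :
    arcGap w (arcSide w u) u' ≤ Real.pi / w * |((u' - u : ℤ) : ℝ)| := by
  have hpw : 0 ≤ Real.pi / w := by positivity
  unfold arcGap
  split_ifs with h
  · positivity
  · have h1 := Real.abs_sin_sub_sin_le (arcAngle w u') (arcAngle w u)
    have h2 : |arcAngle w u' - arcAngle w u| = Real.pi / w * |((u' - u : ℤ) : ℝ)| := by
      have : arcAngle w u' - arcAngle w u = Real.pi / w * ((u' - u : ℤ) : ℝ) := by
        unfold arcAngle; push_cast; ring
      rw [this, abs_mul, abs_of_nonneg hpw]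
    rw [h2] at h1
    refine le_trans ?_ h1
    unfold arcSide at h
    by_cases h3 : 0 ≤ Real.sin (arcAngle w u) <;> by_cases h4 : 0 ≤ Real.sin (arcAngle w u') <;>
      simp [h3, h4] at h
    · rw [abs_of_neg (not_le.1 h4), abs_of_nonpos (by linarith [not_le.1 h4])]; linarith
    · rw [abs_of_nonneg h4, abs_of_nonneg (by linarith [not_le.1 h3])]; linarith [not_le.1 h3]

theorem arcAngle_add_period {w : ℕ} (hw : 0 < w) (u : ℤ) :
    arcAngle w (u + (2 * w : ℕ)) = arcAngle w u + 2 * Real.pi := by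
  have : (w : ℝ) ≠ 0 := by exact_mod_cast hw.ne'
  unfold arcAngle
  push_cast
  field_simp
  ring

theorem sin_arcAngle_ne_zero {w : ℕ} (hw : 0 < w) (u : ℤ) : Real.sin (arcAngle w u) ≠ 0 := by
  intro h
  obtain ⟨k, hk⟩ := Real.sin_eq_zero_iff.1 h
  have hw' : (w : ℝ) ≠ 0 := by exact_mod_cast hw.ne'
  unfold arcAngle at hk
  have h1 : (k : ℝ) * w = u + 1 / 2 := by
    have := Real.pi_ne_zero
    field_simp at hk
    linarith
  have h2 : 2 * (k * w) = 2 * u + 1 := by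
    have : (2 : ℝ) * (k * w) = 2 * u + 1 := by linarith
    exact_mod_cast this
  omega

/-- `±1` according to the half of the circle. -/
noncomputable def arcSign (w : ℕ) (u : ℤ) : ℝ := if arcSide w u then 1 else -1

theorem arcSign_mul_sin (w : ℕ) (u : ℤ) :
    arcSign w u * Real.sin (arcAngle w u) = |Real.sin (arcAngle w u)| := by
  unfold arcSign arcSide
  by_cases h : 0 ≤ Real.sin (arcAngle w u)
  · simp [h, abs_of_nonneg h]
  · simp [h, abs_of_neg (not_le.1 h)]

/-- This form is linear in the stored sign, so that the gap can be averaged over the random shift.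
-/
theorem arcGap_eq (w : ℕ) (u u' : ℤ) :
    arcGap w (arcSide w u) u' =
      (|Real.sin (arcAngle w u')| - arcSign w u * Real.sin (arcAngle w u')) / 2 := by
  rw [← arcSign_mul_sin w u']
  unfold arcGap arcSign
  have := arcSign_mul_sin w u'
  unfold arcSign at this
  rw [← this]
  cases arcSide w u <;> cases arcSide w u' <;> (simp; try ring)

theorem sum_arcSign_mul_cos {w : ℕ} (hw : 0 < w) :
    ∑ p ∈ Finset.range (2 * w), arcSign w p * Real.cos (arcAngle w p) = 0 := by
  set F : ℤ → ℝ := fun p => arcSign w p * Real.cos (arcAngle w p) with hF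
  have hper : ∀ i, F (i + (2 * w : ℕ)) = F i := by
    intro i
    simp only [hF, arcSign, arcSide, arcAngle_add_period hw, Real.sin_add_two_pi,
      Real.cos_add_two_pi, decide_eq_true_eq]
  have hneg : ∀ i : ℤ, F (-1 - i) = -F i := by
    intro i
    have h1 : arcAngle w (-1 - i) = -arcAngle w i := by unfold arcAngle; push_cast; ring
    have h2 := sin_arcAngle_ne_zero hw i
    simp only [hF, arcSign, arcSide, h1, Real.cos_neg, Real.sin_neg]
    rcases lt_or_gt_of_ne h2 with h | h
    · have : ¬ 0 ≤ Real.sin (arcAngle w i) := not_le.2 h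
      simp [this, h.le]
    · have : ¬ Real.sin (arcAngle w i) ≤ 0 := not_le.2 h
      simp [this, h.le]
  -- Reflecting the circle in the real axis keeps the cosine and flips the sign. Midpoints of arcs
  -- never lie on that axis.
  have h1 : ∑ p ∈ Finset.range (2 * w), F p = ∑ p ∈ Finset.range (2 * w), F (-1 - (p : ℤ)) := by
    rw [← Finset.sum_range_reflect]
    refine Finset.sum_congr rfl fun p hp => ?_
    rw [← hper (-1 - p)]
    congr 1
    have := Finset.mem_range.1 hp
    omega
  simp_rw [hneg] at h1
  rw [Finset.sum_neg_distrib] at h1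
  linarith

/-- Since `|sin| ≥ sin²`, the average is at least `1 / 2`; the sum of `cos (2 * arcAngle w p)`
vanishes because it telescopes after multiplication by `2 * sin g`. -/
theorem le_sum_abs_sin_arcAngle {w : ℕ} (hw : 2 ≤ w) :
    (w : ℝ) ≤ ∑ p ∈ Finset.range (2 * w), |Real.sin (arcAngle w p)| := by
  have hw0 : (w : ℝ) ≠ 0 := by positivity
  set g : ℝ := Real.pi / w with hg
  have hsin : 0 < Real.sin g := by
    apply Real.sin_pos_of_pos_of_lt_pi
    · positivity
    · rw [hg, div_lt_iff₀ (by positivity)]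
      have : (2 : ℝ) ≤ w := by exact_mod_cast hw
      nlinarith [Real.pi_pos]
  have htel : ∑ p ∈ Finset.range (2 * w), 2 * Real.sin g * Real.cos (2 * arcAngle w p) = 0 := by
    have e : ∀ p : ℕ, 2 * Real.sin g * Real.cos (2 * arcAngle w p) =
        Real.sin (2 * g * ((p + 1 : ℕ) : ℝ)) - Real.sin (2 * g * (p : ℕ)) := by
      intro p
      have h1 : 2 * g * ((p + 1 : ℕ) : ℝ) = 2 * arcAngle w p + g := by
        unfold arcAngle; push_cast; ring
      have h2 : 2 * g * (p : ℕ) = 2 * arcAngle w p - g := by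
        unfold arcAngle; push_cast; ring
      rw [h1, h2, Real.sin_add, Real.sin_sub]
      ring
    simp_rw [e]
    rw [Finset.sum_range_sub (fun p : ℕ => Real.sin (2 * g * (p : ℝ)))]
    have : 2 * g * ((2 * w : ℕ) : ℝ) = (4 : ℕ) * Real.pi := by
      rw [hg]; push_cast; field_simp; ring
    rw [this, Real.sin_nat_mul_pi]
    simp
  rw [← Finset.mul_sum] at htel
  have h0 : ∑ p ∈ Finset.range (2 * w), Real.cos (2 * arcAngle w p) = 0 := by
    rcases mul_eq_zero.1 htel with h | h
    · linarith
    · exact h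
  calc (w : ℝ) = ∑ p ∈ Finset.range (2 * w), (1 / 2 - Real.cos (2 * arcAngle w p) / 2) := by
        rw [Finset.sum_sub_distrib, ← Finset.sum_div, ← Finset.sum_div, h0]
        simp
    _ ≤ _ := by
        refine Finset.sum_le_sum fun p _ => ?_
        rw [← Real.sin_sq_eq_half_sub, ← sq_abs]
        have h1 := Real.abs_sin_le_one (arcAngle w p)
        nlinarith [abs_nonneg (Real.sin (arcAngle w p))]

/-- Over a random shift the gaps sum to `M * (1 - cos φ) / 2` with `M ≥ w`, and `exp (-t) ≤ 1 - t /
2` on `[0, 1]`. This turns the penalty of a bucket into an affine function of a cosine. -/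
theorem sum_exp_arcGap_le {w : ℕ} (hw : 2 ≤ w) (u u' : ℤ) :
    ∑ p ∈ Finset.range (2 * w), Real.exp (-arcGap w (arcSide w (u + p)) (u' + p)) ≤
      (2 * w) * (1 / 8 * Real.cos (Real.pi / w * ((u' - u : ℤ) : ℝ)) + 7 / 8) := by
  have hw1 : 0 < w := by omega
  set M := ∑ p ∈ Finset.range (2 * w), |Real.sin (arcAngle w p)| with hM
  set φ := Real.pi / w * ((u' - u : ℤ) : ℝ) with hφ
  have hper : ∀ i : ℤ, arcSide w (i + (2 * w : ℕ)) = arcSide w i := fun i => by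
    simp only [arcSide, arcAngle_add_period hw1, Real.sin_add_two_pi]
  have hMs : ∀ u : ℤ, ∑ p ∈ Finset.range (2 * w), |Real.sin (arcAngle w (u + p))| = M :=
    sum_range_shift_of_periodic (fun p => |Real.sin (arcAngle w p)|)
      (fun i => by simp only [arcAngle_add_period hw1, Real.sin_add_two_pi])
  have hC : ∑ p ∈ Finset.range (2 * w), arcSign w (u + p) * Real.cos (arcAngle w (u + p)) = 0 := by
    rw [sum_range_shift_of_periodic (fun p => arcSign w p * Real.cos (arcAngle w p))
      (fun i => by simp only [arcSign, hper, arcAngle_add_period hw1, Real.cos_add_two_pi])]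
    exact sum_arcSign_mul_cos hw1
  have hL : ∑ p ∈ Finset.range (2 * w), arcGap w (arcSide w (u + p)) (u' + p) =
      M * (1 - Real.cos φ) / 2 := by
    have e : ∀ p : ℕ, arcGap w (arcSide w (u + p)) (u' + p) =
        (|Real.sin (arcAngle w (u' + p))| - Real.cos φ * |Real.sin (arcAngle w (u + p))| -
          Real.sin φ * (arcSign w (u + p) * Real.cos (arcAngle w (u + p)))) / 2 := by
      intro p
      have h1 : arcAngle w (u' + p) = arcAngle w (u + p) + φ := by
        rw [hφ]; unfold arcAngle; push_cast; ring
      rw [arcGap_eq, ← arcSign_mul_sin w (u + p)]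
      congr 1
      rw [sub_sub]
      congr 1
      rw [h1, Real.sin_add]
      ring
    simp_rw [e]
    rw [← Finset.sum_div, Finset.sum_sub_distrib, Finset.sum_sub_distrib, ← Finset.mul_sum,
      ← Finset.mul_sum, hMs, hMs, hC]
    ring
  have hexp : ∀ t : ℝ, 0 ≤ t → t ≤ 1 → Real.exp (-t) ≤ 1 - t / 2 := by
    intro t h0 h1
    have h2 := Real.add_one_le_exp t
    have h3 : Real.exp (-t) * Real.exp t = 1 := by rw [← Real.exp_add]; simp
    have h4 := Real.exp_pos (-t)
    have h5 : Real.exp (-t) * (t + 1) ≤ 1 := by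
      rw [← h3]; exact mul_le_mul_of_nonneg_left (by linarith) h4.le
    nlinarith
  have hMw := le_sum_abs_sin_arcAngle hw
  rw [← hM] at hMw
  calc ∑ p ∈ Finset.range (2 * w), Real.exp (-arcGap w (arcSide w (u + p)) (u' + p))
      ≤ ∑ p ∈ Finset.range (2 * w), (1 - arcGap w (arcSide w (u + p)) (u' + p) / 2) :=
        Finset.sum_le_sum fun p _ => hexp _ (arcGap_nonneg _ _ _) (arcGap_le_one _ _ _)
    _ = 2 * w - M * (1 - Real.cos φ) / 4 := by
        rw [Finset.sum_sub_distrib, ← Finset.sum_div, hL]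
        simp
        ring
    _ ≤ _ := by nlinarith [Real.cos_le_one φ]

/-! ### The signed sum sketch -/

theorem signedSum_sub {α : Type*} {m : ℕ} (h : α → Fin m × Bool) (v v' : α → ℤ) (A : Finset α)
    (j : Fin m) : signedSum h v A j - signedSum h v' A j = signedSum h (fun a => v a - v' a) A j := by
  unfold signedSum
  rw [← Finset.sum_sub_distrib]
  refine Finset.sum_congr rfl fun a _ => ?_
  split_ifs <;> ring

theorem sum_abs_signedSum_le {α : Type*} {m : ℕ} (h : α → Fin m × Bool) (v : α → ℤ)
    (A : Finset α) : ∑ j, |signedSum h v A j| ≤ ∑ a ∈ A, |v a| := by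
  calc ∑ j, |signedSum h v A j|
      ≤ ∑ j, ∑ a ∈ A, |if (h a).1 = j then (if (h a).2 then v a else -v a) else 0| :=
        Finset.sum_le_sum fun j _ => Finset.abs_sum_le_sum_abs _ _
    _ = ∑ a ∈ A, ∑ j, |if (h a).1 = j then (if (h a).2 then v a else -v a) else 0| :=
        Finset.sum_comm
    _ = ∑ a ∈ A, |v a| := by
        refine Finset.sum_congr rfl fun a _ => ?_
        rw [Finset.sum_eq_single (h a).1]
        · rw [if_pos rfl]
          split_ifs <;> simp
        · intro j _ hj
          rw [if_neg hj.symm, abs_zero]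
        · simp

/-- The difference of the bits of two points at a repeated coordinate. -/
def bitDiff {d k : ℕ} (q x : Cube d) (a : Fin d × Fin k) : ℤ :=
  (if q a.1 then 1 else 0) - (if x a.1 then 1 else 0)

theorem bitDiff_cases {d k : ℕ} (q x : Cube d) (a : Fin d × Fin k) :
    (q a.1 = x a.1 ∧ bitDiff q x a = 0) ∨ (q a.1 ≠ x a.1 ∧ bitDiff q x a = 1) ∨
      (q a.1 ≠ x a.1 ∧ bitDiff q x a = -1) := by
  unfold bitDiff
  cases q a.1 <;> cases x a.1 <;> simp

theorem sum_abs_bitDiff {d k : ℕ} (q x : Cube d) :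
    ∑ a : Fin d × Fin k, |bitDiff q x a| = (k * hammingDist q x : ℕ) := by
  rw [← card_filter_ne_fst (k := k) q x, Finset.card_filter, Nat.cast_sum]
  refine Finset.sum_congr rfl fun a _ => ?_
  rcases bitDiff_cases q x a with ⟨h, h'⟩ | ⟨h, h'⟩ | ⟨h, h'⟩ <;> simp [h, h']

theorem sum_one_sub_cos_bitDiff {d k : ℕ} (q x : Cube d) (γ : ℝ) :
    ∑ a : Fin d × Fin k, (1 - Real.cos (γ * bitDiff q x a)) =
      k * hammingDist q x * (1 - Real.cos γ) := by
  have h1 : (k * hammingDist q x : ℝ) =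
      ((Finset.univ.filter fun a : Fin d × Fin k => q a.1 ≠ x a.1).card : ℝ) := by
    rw [card_filter_ne_fst]; push_cast; rfl
  rw [h1, Finset.card_filter, Nat.cast_sum, Finset.sum_mul]
  refine Finset.sum_congr rfl fun a _ => ?_
  rcases bitDiff_cases q x a with ⟨h, h'⟩ | ⟨h, h'⟩ | ⟨h, h'⟩ <;> simp [h, h']

/-- Quantized random signed sums over the buckets of a random partition of the coordinates, each
repeated `k` times. -/
theorem hasPointSketch_signedSum {d m k w : ℕ} {r c δ D₀ : ℝ} (hm : 0 < m) (hw : 2 ≤ w)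
    (hfar : ∀ t : ℕ, c * r < t → D₀ ≤ t) (hD₀ : (w : ℝ) ^ 2 * m ≤ 2 * (k * D₀))
    (hnear : Real.pi / w * (k * r) ≤ m / 32) (hδ : Real.exp (-(m / 32 : ℝ)) ≤ δ) :
    HasPointSketch d m r c δ := by
  classical
  have : NeZero m := ⟨hm.ne'⟩
  have : NeZero (2 * w) := ⟨by omega⟩
  have hw0 : (0 : ℝ) < w := by positivity
  have hm0 : (0 : ℝ) < m := by exact_mod_cast hm
  let bit : Cube d → Fin d × Fin k → ℤ := fun x a => if x a.1 then 1 else 0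
  have hdiff : ∀ (h : Fin d × Fin k → Fin m × Bool) (q x : Cube d) (j : Fin m),
      signedSum h (bit q) Finset.univ j - signedSum h (bit x) Finset.univ j =
        signedSum h (bitDiff q x) Finset.univ j := fun h q x j => signedSum_sub _ _ _ _ _
  refine ⟨(Fin d × Fin k → Fin m × Bool) × (Fin m → Fin (2 * w)), inferInstance, inferInstance,
    fun ω x j => arcSide w (signedSum ω.1 (bit x) Finset.univ j + (ω.2 j : ℕ)),
    fun ω mem q => decide (∑ j, arcGap w (mem j)
      (signedSum ω.1 (bit q) Finset.univ j + (ω.2 j : ℕ)) ≤ Real.pi / w * (k * r)), ?_, ?_⟩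
  · intro ω x q hqx
    rw [decide_eq_true_iff]
    calc ∑ j, arcGap w (arcSide w (signedSum ω.1 (bit x) Finset.univ j + (ω.2 j : ℕ)))
          (signedSum ω.1 (bit q) Finset.univ j + (ω.2 j : ℕ))
        ≤ ∑ j, Real.pi / w * |((signedSum ω.1 (bitDiff q x) Finset.univ j : ℤ) : ℝ)| := by
          refine Finset.sum_le_sum fun j _ => (arcGap_le _ _ _).trans_eq ?_
          rw [← hdiff, add_sub_add_right_eq_sub]
      _ = Real.pi / w * ((∑ j, |signedSum ω.1 (bitDiff q x) Finset.univ j| : ℤ) : ℝ) := by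
          rw [← Finset.mul_sum]; push_cast; rfl
      _ ≤ Real.pi / w * ((k * hammingDist q x : ℕ) : ℝ) := by
          have := sum_abs_signedSum_le ω.1 (bitDiff q x) Finset.univ
          rw [sum_abs_bitDiff] at this
          gcongr
          exact_mod_cast this
      _ ≤ Real.pi / w * (k * r) := by
          push_cast
          gcongr
  · intro x q hqx
    simp only [decide_eq_true_iff]
    refine (card_filter_le_exp_mul_sum _ _).trans ?_
    have hD : D₀ ≤ hammingDist q x := hfar _ hqx
    set γ : ℝ := Real.pi / w with hγ
    have hγ2 : γ ≤ Real.pi / 2 := by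
      have : (2 : ℝ) ≤ w := by exact_mod_cast hw
      rw [hγ]; gcongr
    have hγ0 : 0 ≤ γ := by positivity
    have hcos0 : 0 ≤ Real.cos γ := Real.cos_nonneg_of_neg_pi_div_two_le_of_le (by linarith) hγ2
    have hcosa : ∀ a : Fin d × Fin k, 0 ≤ Real.cos (γ * bitDiff q x a) := by
      intro a
      rcases bitDiff_cases q x a with ⟨h, h'⟩ | ⟨h, h'⟩ | ⟨h, h'⟩ <;> simp [h', hcos0]
    have hcos : 2 / (w : ℝ) ^ 2 ≤ 1 - Real.cos γ := by
      have h1 := Real.cos_le_one_sub_mul_cos_sq (x := γ)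
        (by rw [abs_of_nonneg hγ0]; linarith [Real.pi_pos])
      have h2 : 2 / Real.pi ^ 2 * γ ^ 2 = 2 / (w : ℝ) ^ 2 := by
        have := Real.pi_ne_zero
        rw [hγ]; field_simp
      linarith
    -- By `1 - cos γ ≥ 2 / w ^ 2`, the condition on `w ^ 2 * m` makes the exponent at least one per
    -- bucket. Each bucket then costs a factor `1 / 8 * 1 / 2 + 7 / 8 = 15 / 16`.
    have hE : Real.exp (-((∑ a : Fin d × Fin k, (1 - Real.cos (γ * bitDiff q x a))) / m)) ≤ 1 / 2 := by
      have h1 : 1 ≤ (∑ a : Fin d × Fin k, (1 - Real.cos (γ * bitDiff q x a))) / m := by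
        rw [sum_one_sub_cos_bitDiff, le_div_iff₀ hm0, one_mul]
        calc (m : ℝ) = w ^ 2 * m * (1 / w ^ 2) := by field_simp
          _ ≤ 2 * (k * D₀) * (1 / w ^ 2) := by gcongr
          _ = (k * D₀) * (2 / w ^ 2) := by ring
          _ ≤ (k * hammingDist q x) * (2 / w ^ 2) := by gcongr
          _ ≤ _ := by gcongr
      calc _ ≤ Real.exp (-1) := Real.exp_le_exp.2 (by linarith)
        _ ≤ 1 / 2 := by
          have h3 : Real.exp (-1) * Real.exp 1 = 1 := by rw [← Real.exp_add]; simp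
          nlinarith [Real.add_one_le_exp (1 : ℝ), Real.exp_pos (-1 : ℝ)]
    have hsum : ∑ ω : (Fin d × Fin k → Fin m × Bool) × (Fin m → Fin (2 * w)),
        Real.exp (-∑ j, arcGap w
          (arcSide w (signedSum ω.1 (bit x) Finset.univ j + (ω.2 j : ℕ)))
          (signedSum ω.1 (bit q) Finset.univ j + (ω.2 j : ℕ))) ≤
        Fintype.card ((Fin d × Fin k → Fin m × Bool) × (Fin m → Fin (2 * w))) *
          (15 / 16) ^ m := by
      rw [Fintype.sum_prod_type]
      have h1 : ∀ h : Fin d × Fin k → Fin m × Bool, ∑ p : Fin m → Fin (2 * w),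
          Real.exp (-∑ j, arcGap w (arcSide w (signedSum h (bit x) Finset.univ j + (p j : ℕ)))
            (signedSum h (bit q) Finset.univ j + (p j : ℕ))) ≤
          (2 * w) ^ m * ∏ j, (1 / 8 * Real.cos (γ * signedSum h (bitDiff q x) Finset.univ j) +
            7 / 8) := by
        intro h
        simp_rw [← Finset.sum_neg_distrib, Real.exp_sum]
        have h2 := Finset.prod_univ_sum (fun _ : Fin m => (Finset.univ : Finset (Fin (2 * w))))
          (fun j p => Real.exp (-arcGap w
            (arcSide w (signedSum h (bit x) Finset.univ j + (p : ℕ)))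
            (signedSum h (bit q) Finset.univ j + (p : ℕ))))
        rw [Fintype.piFinset_univ] at h2
        rw [← h2]
        calc _ ≤ ∏ j : Fin m, ((2 * w) *
              (1 / 8 * Real.cos (γ * signedSum h (bitDiff q x) Finset.univ j) + 7 / 8)) := by
              refine Finset.prod_le_prod (fun j _ => Finset.sum_nonneg fun p _ =>
                (Real.exp_pos _).le) fun j _ => ?_
              rw [← hdiff, Fin.sum_univ_eq_sum_range (fun p : ℕ => Real.exp (-arcGap w
                (arcSide w (signedSum h (bit x) Finset.univ j + (p : ℕ)))
                (signedSum h (bit q) Finset.univ j + (p : ℕ))))]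
              exact sum_exp_arcGap_le hw _ _
          _ = _ := by rw [Finset.prod_mul_distrib]; simp
      calc _ ≤ ∑ h : Fin d × Fin k → Fin m × Bool, (2 * w : ℝ) ^ m *
            ∏ j, (1 / 8 * Real.cos (γ * signedSum h (bitDiff q x) Finset.univ j) + 7 / 8) :=
            Finset.sum_le_sum fun h _ => h1 h
        _ ≤ (2 * w : ℝ) ^ m * (Fintype.card (Fin d × Fin k → Fin m × Bool) * (15 / 16) ^ m) := by
            rw [← Finset.mul_sum]
            gcongr
            refine (sum_prod_affine_cos_signedSum_le hm _ γ hcosa).trans ?_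
            gcongr
            linarith
        _ = _ := by
            rw [Fintype.card_prod, Nat.cast_mul, Fintype.card_fun (α := Fin m)]
            simp only [Fintype.card_fin]
            push_cast
            ring
    have h15 : (15 / 16 : ℝ) ^ m ≤ Real.exp (-(m / 16 : ℝ)) := by
      have h1 : (15 / 16 : ℝ) ≤ Real.exp (-(1 / 16)) := by
        have := Real.add_one_le_exp (-(1 / 16) : ℝ)
        linarith
      calc (15 / 16 : ℝ) ^ m ≤ Real.exp (-(1 / 16)) ^ m := by gcongr
        _ = _ := by rw [← Real.exp_nat_mul]; congr 1; ring
    have hN : (0 : ℝ) ≤ Fintype.card ((Fin d × Fin k → Fin m × Bool) × (Fin m → Fin (2 * w))) :=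
      Nat.cast_nonneg _
    calc _ ≤ Real.exp (m / 32) *
          (Fintype.card ((Fin d × Fin k → Fin m × Bool) × (Fin m → Fin (2 * w))) *
            Real.exp (-(m / 16 : ℝ))) := by
          refine mul_le_mul (Real.exp_le_exp.2 hnear) (hsum.trans ?_)
            (Finset.sum_nonneg fun _ _ => (Real.exp_pos _).le) (Real.exp_pos _).le
          gcongr
      _ = Real.exp (-(m / 32 : ℝ)) *
          Fintype.card ((Fin d × Fin k → Fin m × Bool) × (Fin m → Fin (2 * w))) := by
          have : Real.exp (-(m / 32 : ℝ)) = Real.exp (m / 32) * Real.exp (-(m / 16 : ℝ)) := by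
            rw [← Real.exp_add]; congr 1; ring
          rw [this]; ring
      _ ≤ _ := by gcongr

/-! ### Choice of parameters and the upper bound -/

theorem le_of_mul_lt_natCast {r c : ℝ} (hr : 0 ≤ r) (hc : 1 < c) (t : ℕ) (ht : c * r < t) :
    max (c * r) 1 ≤ t := by
  refine max_le ht.le ?_
  have h0 : 0 ≤ c * r := by positivity
  have : (0 : ℝ) < t := h0.trans_lt ht
  exact_mod_cast this

theorem one_le_logb_one_div {δ : ℝ} (hδ : 0 < δ) (hδ' : δ ≤ 1 / 2) :
    1 ≤ Real.logb 2 (1 / δ) := by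
  rw [Real.le_logb_iff_rpow_le (by norm_num) (by positivity), Real.rpow_one,
    le_div_iff₀ hδ]
  linarith

theorem log_one_div_le_logb {δ : ℝ} (hδ : 0 < δ) (hδ' : δ ≤ 1 / 2) :
    Real.log (1 / δ) ≤ 7 / 10 * Real.logb 2 (1 / δ) := by
  have h1 := one_le_logb_one_div hδ hδ'
  have h2 : Real.logb 2 (1 / δ) * Real.log 2 = Real.log (1 / δ) :=
    div_mul_cancel₀ _ (Real.log_pos (by norm_num)).ne'
  rw [← h2]
  nlinarith [Real.log_two_lt_d9]

theorem exists_pointSketch_parity (d : ℕ) {r c δ : ℝ} (hr : 0 ≤ r) (hc : 1 < c) (hδ : 0 < δ)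
    (hδ' : δ ≤ 1 / 2) :
    ∃ m : ℕ, HasPointSketch d m r c δ ∧
      (m : ℝ) ≤ 36 * c ^ 2 * (r / (c - 1)) + 325 * ((c / (c - 1)) ^ 2 * Real.logb 2 (1 / δ)) := by
  have hc1 : 0 < c - 1 := by linarith
  -- Far distances are positive integers; the `1` keeps `D₀` away from zero when `r` is small, so
  -- that the number of repetitions can be chosen.
  set D₀ := max (c * r) 1 with hD₀
  have hD1 : 1 ≤ D₀ := le_max_right _ _
  have hDr : c * r ≤ D₀ := le_max_left _ _
  have hDle : D₀ ≤ c * r + 1 := max_le (by linarith) (by nlinarith)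
  set u := c / (c - 1) with hu
  have hu1 : 1 ≤ u := by rw [hu, le_div_iff₀ hc1]; linarith
  set L := Real.logb 2 (1 / δ) with hL
  have hL1 : 1 ≤ L := one_le_logb_one_div hδ hδ'
  set θ := 1 / u with hθ
  have hθ0 : 0 < θ := by positivity
  have hθ1 : θ ≤ 1 := by rw [hθ, div_le_one (by positivity)]; exact hu1
  have hθu : θ * u = 1 := by rw [hθ]; field_simp
  have hθc : 1 - θ = 1 / c := by rw [hθ, hu]; field_simp; ring
  set ℓ := Real.log (10 / δ) with hℓ
  have hℓL : ℓ ≤ 4 * L := by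
    have h1 : ℓ = Real.log 10 + Real.log (1 / δ) := by
      rw [hℓ, ← Real.log_mul (by norm_num) (by positivity)]; congr 1; ring
    have h2 : Real.log 10 ≤ 4 * Real.log 2 := by
      calc Real.log 10 ≤ Real.log (2 ^ 4) := Real.log_le_log (by norm_num) (by norm_num)
        _ = _ := by rw [Real.log_pow]; norm_num
    have h3 := log_one_div_le_logb hδ hδ'
    linarith [Real.log_two_lt_d9]
  have hℓ0 : 0 < ℓ := Real.log_pos (by rw [lt_div_iff₀ hδ]; linarith)
  -- Enough copies that `exp (-(θ * k * D₀ / 2))` beats `δ / 10`, where `θ = 1 / u = 1 - 1 / c`.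
  set k := ⌈2 * ℓ * u / D₀⌉₊ with hk
  have hk1 : 2 * ℓ * u ≤ k * D₀ := by
    rw [← div_le_iff₀ (by positivity)]; exact Nat.le_ceil _
  have hk2 : k * D₀ ≤ 2 * ℓ * u + D₀ := by
    have := (Nat.ceil_lt_add_one (show 0 ≤ 2 * ℓ * u / D₀ by positivity)).le
    calc k * D₀ ≤ (2 * ℓ * u / D₀ + 1) * D₀ := by gcongr
      _ = _ := by field_simp
  have hkD : 0 < k * D₀ := lt_of_lt_of_le (by positivity) hk1
  set m := ⌈36 * (k * D₀) * u⌉₊ with hm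
  have hm1 : 36 * (k * D₀) * u ≤ m := Nat.le_ceil _
  have hm2 : m ≤ 36 * (k * D₀) * u + 1 :=
    (Nat.ceil_lt_add_one (show 0 ≤ 36 * (k * D₀) * u by positivity)).le
  refine ⟨m, hasPointSketch_parity (k := k) (D₀ := D₀) (θ := θ) ?_ hθ0 hθ1 (by linarith) ?_
    (le_of_mul_lt_natCast hr hc) ?_ ?_, ?_⟩
  · exact Nat.ceil_pos.2 (by positivity)
  · rw [hθc, one_div, ← div_eq_inv_mul, le_div_iff₀ (by linarith)]; linarith
  · calc 36 * (k * D₀) = θ * (36 * (k * D₀) * u) := by linear_combination -36 * (k * D₀) * hθu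
      _ ≤ θ * m := by gcongr
  · have h1 : ℓ ≤ θ * (k * D₀) / 2 := by
      have := mul_le_mul_of_nonneg_left hk1 hθ0.le
      have h2 : θ * (2 * ℓ * u) = 2 * ℓ := by linear_combination 2 * ℓ * hθu
      linarith
    calc 10 * Real.exp (-(θ * (k * D₀) / 2)) ≤ 10 * Real.exp (-ℓ) := by gcongr
      _ = δ := by rw [hℓ, Real.exp_neg, Real.exp_log (by positivity)]; field_simp
  · have h1 : c * r * u = c ^ 2 * (r / (c - 1)) := by rw [hu]; field_simp
    have h2 : k * D₀ * u ≤ (2 * ℓ * u + (c * r + 1)) * u := by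
      gcongr; linarith
    have h3 : ℓ * u ^ 2 ≤ 4 * L * u ^ 2 := by gcongr
    have h4 : u ≤ u ^ 2 * L := by nlinarith
    have h5 : 1 ≤ u ^ 2 * L := by nlinarith
    nlinarith

theorem exists_pointSketch_signedSum (d : ℕ) {r c δ : ℝ} (hr : 0 ≤ r) (hc : 512 ≤ c)
    (hδ : 0 < δ) (hδ' : δ ≤ 1 / 2) :
    ∃ m : ℕ, HasPointSketch d m r c δ ∧
      (m : ℝ) ≤ 200000 * (r / c + Real.logb 2 (1 / δ)) := by
  have hc0 : 0 < c := by linarith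
  set D₀ := max (c * r) 1 with hD₀
  have hD1 : 1 ≤ D₀ := le_max_right _ _
  have hDr : c * r ≤ D₀ := le_max_left _ _
  have hDle : D₀ ≤ c * r + 1 := max_le (by linarith) (by nlinarith)
  set L := Real.logb 2 (1 / δ) with hL
  have hL1 : 1 ≤ L := one_le_logb_one_div hδ hδ'
  set m := ⌈200000 * (D₀ / c ^ 2) + 32 * L⌉₊ with hm
  have hm1 : 200000 * (D₀ / c ^ 2) + 32 * L ≤ m := Nat.le_ceil _
  have hm2 : m ≤ 200000 * (D₀ / c ^ 2) + 32 * L + 1 :=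
    (Nat.ceil_lt_add_one (by positivity)).le
  have hDc : 0 ≤ D₀ / c ^ 2 := by positivity
  have hm0 : (0 : ℝ) < m := by linarith
  -- Enough copies that the circle size `w ≈ √(k * D₀ / m)` is at least `2`.
  set k := ⌈4 * m / D₀⌉₊ with hk
  have hk1 : 4 * m ≤ k * D₀ := by
    rw [← div_le_iff₀ (by positivity)]; exact Nat.le_ceil _
  have hk2 : k * D₀ ≤ 4 * m + D₀ := by
    have := (Nat.ceil_lt_add_one (show 0 ≤ 4 * m / D₀ by positivity)).le
    calc k * D₀ ≤ (4 * m / D₀ + 1) * D₀ := by gcongr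
      _ = _ := by field_simp
  set y := Real.sqrt (k * D₀ / m) with hy
  have hy2 : y ^ 2 = k * D₀ / m := Real.sq_sqrt (div_nonneg (by linarith) hm0.le)
  have hy2m : y ^ 2 * m = k * D₀ := by rw [hy2]; field_simp
  have hy2' : 2 ≤ y := by
    rw [hy, Real.le_sqrt' (by norm_num), le_div_iff₀ hm0]; linarith
  set w := ⌊y⌋₊ with hw
  have hw2 : 2 ≤ w := Nat.le_floor (by exact_mod_cast hy2')
  have hwy : (w : ℝ) ≤ y := Nat.floor_le (by linarith)
  have hyw : y / 2 ≤ w := by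
    have := (Nat.lt_floor_add_one y).le
    linarith
  refine ⟨m, hasPointSketch_signedSum (k := k) (w := w) (D₀ := D₀) (by exact_mod_cast hm0) hw2
    (le_of_mul_lt_natCast hr (by linarith)) ?_ ?_ ?_, ?_⟩
  · calc (w : ℝ) ^ 2 * m ≤ y ^ 2 * m := by gcongr
      _ ≤ 2 * (k * D₀) := by rw [hy2m]; linarith
  · have hDm : D₀ ≤ c ^ 2 / 200000 * m := by
      have : 200000 * (D₀ / c ^ 2) ≤ m := by linarith
      rw [← mul_div_assoc, div_le_iff₀ (by positivity)] at this
      linarith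
    -- The angle bound for near points is about `6.3 * (y / c) * m`, which must stay below `m / 32`.
    -- This dictates `208`, and then `y ^ 2 ≤ 4 + c ^ 2 / 200000` suffices from `c = 512` on.
    have hyc : y ≤ c / 208 := by
      apply le_of_sq_le_sq _ (by positivity)
      have h1 : y ^ 2 * m ≤ (4 + c ^ 2 / 200000) * m := by rw [hy2m]; linarith
      have h2 := le_of_mul_le_mul_right h1 hm0
      nlinarith
    have hkr : k * r ≤ y ^ 2 * m / c := by
      rw [hy2m, le_div_iff₀ hc0]
      have := mul_le_mul_of_nonneg_left hDr (Nat.cast_nonneg (α := ℝ) k)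
      linarith
    have hpi := Real.pi_lt_d2
    calc Real.pi / w * (k * r) ≤ 3.15 / (y / 2) * (y ^ 2 * m / c) := by gcongr
      _ = 6.3 * (y / c) * m := by field_simp; ring
      _ ≤ 6.3 * (1 / 208) * m := by
        have : y / c ≤ 1 / 208 := by rw [div_le_iff₀ hc0]; linarith
        gcongr
      _ ≤ m / 32 := by linarith
  · have h1 : Real.log (1 / δ) ≤ m / 32 := by
      have := log_one_div_le_logb hδ hδ'
      linarith
    calc Real.exp (-(m / 32 : ℝ)) ≤ Real.exp (-Real.log (1 / δ)) := by gcongr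
      _ = δ := by rw [Real.exp_neg, Real.exp_log (by positivity)]; field_simp
  · have h1 : D₀ / c ^ 2 ≤ r / c + 1 / c ^ 2 := by
      calc D₀ / c ^ 2 ≤ (c * r + 1) / c ^ 2 := by gcongr
        _ = _ := by field_simp
    have h2 : 1 / c ^ 2 ≤ 1 / 200000 := by
      apply one_div_le_one_div_of_le (by norm_num); nlinarith
    linarith

theorem exists_pointSketch : ∃ C : ℝ, 0 < C ∧ ∀ (d : ℕ) (r c δ : ℝ), 0 ≤ r → 1 < c → 0 < δ →
    δ ≤ 1 / 2 → ∃ m : ℕ, HasPointSketch d m r c δ ∧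
      (m : ℝ) ≤ C * (r / (c - 1) + (c / (c - 1)) ^ 2 * Real.logb 2 (1 / δ)) ∧
      (2 ≤ c → (m : ℝ) ≤ C * (r / c + Real.logb 2 (1 / δ))) := by
  refine ⟨20000000, by norm_num, fun d r c δ hr hc hδ hδ' => ?_⟩
  have hc1 : 0 < c - 1 := by linarith
  set L := Real.logb 2 (1 / δ) with hL
  have hL1 : 1 ≤ L := one_le_logb_one_div hδ hδ'
  set u := c / (c - 1) with hu
  have hu1 : 1 ≤ u := by rw [hu, le_div_iff₀ hc1]; linarith
  have hX : 0 ≤ r / (c - 1) := by positivity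
  have hY : 0 ≤ u ^ 2 * L := by positivity
  have hZ : 0 ≤ r / c := by positivity
  -- The parity sketch loses a factor `c ^ 2` in the term `r / (c - 1)`, which is a constant up to
  -- `512`.
  rcases le_total c 512 with h | h
  · obtain ⟨m, hm, hle⟩ := exists_pointSketch_parity d hr hc hδ hδ'
    have h1 : 36 * c ^ 2 * (r / (c - 1)) ≤ 10000000 * (r / (c - 1)) := by
      gcongr; nlinarith
    refine ⟨m, hm, ?_, fun h2 => ?_⟩
    · refine hle.trans ?_
      linarith
    · have h3 : r / (c - 1) ≤ 2 * (r / c) := by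
        rw [← mul_div_assoc, div_le_div_iff₀ hc1 (by linarith)]; nlinarith
      have h4 : u ≤ 2 := by rw [hu, div_le_iff₀ hc1]; linarith
      have h5 : u ^ 2 * L ≤ 2 ^ 2 * L := by gcongr
      refine hle.trans ?_
      linarith
  · obtain ⟨m, hm, hle⟩ := exists_pointSketch_signedSum d hr h hδ hδ'
    refine ⟨m, hm, ?_, fun _ => by linarith⟩
    have h3 : r / c ≤ r / (c - 1) := by gcongr; linarith
    have h4 : L ≤ u ^ 2 * L := le_mul_of_one_le_left (by linarith) (one_le_pow₀ hu1)
    linarith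

theorem exists_filter : ∃ C : ℝ, 0 < C ∧
    ∀ (d n : ℕ) (r c ε : ℝ), 1 ≤ n → 0 ≤ r → 1 < c → 0 < ε → ε ≤ 1 → 2 * ε ≤ (n : ℝ) →
      ∃ (s : ℕ) (F : RandFilter d s), RandFilter.HasPointwiseError F n r c ε ∧
        (s : ℝ) ≤ C * (n * (r / (c - 1) + (c / (c - 1)) ^ 2 * Real.logb 2 (n / ε))) ∧
        (2 ≤ c → (s : ℝ) ≤ C * (n * (r / c + Real.logb 2 (n / ε)))) := by
  obtain ⟨C, hC, H⟩ := exists_pointSketch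
  refine ⟨C, hC, fun d n r c ε hn hr hc hε _ hεn => ?_⟩
  have hn0 : (0 : ℝ) < n := by exact_mod_cast hn
  -- The sketches require `ε / n ≤ 1 / 2`, that is, `2 * ε ≤ n`.
  obtain ⟨m, hm, h1, h2⟩ := H d r c (ε / n) hr hc (by positivity)
    (by rw [div_le_iff₀ hn0]; linarith)
  obtain ⟨F, hF⟩ := hm.exists_filter (n := n) (ε := ε) (mul_div_cancel₀ _ hn0.ne').le
  rw [one_div_div] at h1 h2
  refine ⟨n * m, F, hF, ?_, fun hc2 => ?_⟩
  · push_cast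
    calc (n : ℝ) * m ≤ n * _ := mul_le_mul_of_nonneg_left h1 hn0.le
      _ = _ := by ring
  · push_cast
    calc (n : ℝ) * m ≤ n * _ := mul_le_mul_of_nonneg_left (h2 hc2) hn0.le
      _ = _ := by ring

/-! ### Concentration and isoperimetry in the cube -/

/-- Hoeffding's lemma for a fair coin, from `cosh x ≤ exp (x ^ 2 / 2)`; it drives the induction on
the dimension. -/
theorem exp_add_exp_le (a b : ℝ) :
    Real.exp a + Real.exp b ≤ 2 * Real.exp ((a + b) / 2 + (a - b) ^ 2 / 8) := by
  have h1 := Real.cosh_le_exp_half_sq ((a - b) / 2)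
  have h2 : Real.exp a + Real.exp b = 2 * (Real.exp ((a + b) / 2) * Real.cosh ((a - b) / 2)) := by
    rw [Real.cosh_eq]
    have e1 : Real.exp a = Real.exp ((a + b) / 2) * Real.exp ((a - b) / 2) := by
      rw [← Real.exp_add]; congr 1; ring
    have e2 : Real.exp b = Real.exp ((a + b) / 2) * Real.exp (-((a - b) / 2)) := by
      rw [← Real.exp_add]; congr 1; ring
    rw [e1, e2]; ring
  have h3 : ((a - b) / 2) ^ 2 / 2 = (a - b) ^ 2 / 8 := by ring
  rw [h2, Real.exp_add, ← h3]
  gcongr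

theorem sum_cube_succ {d : ℕ} (g : Cube (d + 1) → ℝ) :
    ∑ x, g x = ∑ x : Cube d, g (Fin.cons true x) + ∑ x : Cube d, g (Fin.cons false x) := by
  rw [← (Fin.consEquiv fun _ : Fin (d + 1) => Bool).sum_comp g, Fintype.sum_prod_type,
    Fintype.sum_bool]
  rfl

/-- The Laplace transform of a function with bounded differences on the cube. -/
theorem sum_exp_mul_le_of_boundedDiff (t : ℝ) : ∀ (d : ℕ) (f : Cube d → ℝ),
    (∀ x i b, f x ≤ f (Function.update x i b) + 1) →
    ∑ x, Real.exp (t * f x) ≤ 2 ^ d * Real.exp (t * ((∑ x, f x) / 2 ^ d) + t ^ 2 * d / 8)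
  | 0, f, _ => by simp
  | d + 1, f, hf => by
    have h1 := sum_exp_mul_le_of_boundedDiff t d (fun x => f (Fin.cons true x)) (by
      intro x i b
      rw [Fin.cons_update]
      exact hf _ _ _)
    have h0 := sum_exp_mul_le_of_boundedDiff t d (fun x => f (Fin.cons false x)) (by
      intro x i b
      rw [Fin.cons_update]
      exact hf _ _ _)
    rw [sum_cube_succ, sum_cube_succ]
    set a1 := (∑ x : Cube d, f (Fin.cons true x)) / 2 ^ d with ha1
    set a0 := (∑ x : Cube d, f (Fin.cons false x)) / 2 ^ d with ha0
    have hp : (0 : ℝ) < 2 ^ d := by positivity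
    have hle : ∀ b b' : Bool, (∑ x : Cube d, f (Fin.cons b x)) / 2 ^ d ≤
        (∑ x : Cube d, f (Fin.cons b' x)) / 2 ^ d + 1 := by
      intro b b'
      rw [div_add_one hp.ne', div_le_div_iff_of_pos_right hp]
      calc ∑ x : Cube d, f (Fin.cons b x) ≤ ∑ x : Cube d, (f (Fin.cons b' x) + 1) := by
            refine Finset.sum_le_sum fun x _ => ?_
            have := hf (Fin.cons b x) 0 b'
            rwa [Fin.update_cons_zero] at this
        _ = _ := by simp [Finset.sum_add_distrib]
    have hd1 := hle true false
    have hd0 := hle false true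
    rw [← ha1, ← ha0] at hd1 hd0
    have hmean : (∑ x : Cube d, f (Fin.cons true x) + ∑ x : Cube d, f (Fin.cons false x)) /
        2 ^ (d + 1) = (a1 + a0) / 2 := by
      rw [ha1, ha0]; field_simp; ring
    rw [hmean]
    have key := exp_add_exp_le (t * a1) (t * a0)
    have hsq : (t * a1 - t * a0) ^ 2 ≤ t ^ 2 := by
      have : (a1 - a0) ^ 2 ≤ 1 := by nlinarith
      nlinarith [sq_nonneg t]
    calc _ ≤ 2 ^ d * Real.exp (t * a1 + t ^ 2 * d / 8) + 2 ^ d * Real.exp (t * a0 + t ^ 2 * d / 8) :=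
          add_le_add h1 h0
      _ = 2 ^ d * Real.exp (t ^ 2 * d / 8) * (Real.exp (t * a1) + Real.exp (t * a0)) := by
          rw [Real.exp_add, Real.exp_add]; ring
      _ ≤ 2 ^ d * Real.exp (t ^ 2 * d / 8) *
          (2 * Real.exp ((t * a1 + t * a0) / 2 + t ^ 2 / 8)) := by
          gcongr
          refine key.trans ?_
          gcongr
      _ = 2 ^ (d + 1) * (Real.exp (t ^ 2 * d / 8) *
          Real.exp ((t * a1 + t * a0) / 2 + t ^ 2 / 8)) := by ring
      _ = _ := by
          rw [← Real.exp_add]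
          congr 2
          push_cast
          ring

theorem hammingDist_update_le {d : ℕ} (x : Cube d) (i : Fin d) (b : Bool) :
    hammingDist x (Function.update x i b) ≤ 1 := by
  unfold hammingDist
  rw [← Finset.card_singleton i]
  refine Finset.card_le_card fun j hj => ?_
  rw [Finset.mem_singleton]
  by_contra h
  simp [Function.update_of_ne h] at hj

/-- Two sets at Hamming distance at least `ρ` cannot both be large. -/
theorem card_mul_card_le_of_far {d : ℕ} (A B : Finset (Cube d)) (ρ : ℝ) (hρ : 0 ≤ ρ)
    (h : ∀ a ∈ A, ∀ b ∈ B, ρ ≤ hammingDist b a) :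
    (A.card : ℝ) * B.card ≤ 4 ^ d * Real.exp (-(ρ ^ 2 / d)) := by
  rcases A.eq_empty_or_nonempty with rfl | hA
  · simp; positivity
  -- The distance to `A` has bounded differences, vanishes on `A` and is at least `ρ` on `B`.
  -- Multiplying its Laplace bounds at `-t` and `t` cancels the mean, and `t = 2 * ρ / d` minimizes
  -- `t ^ 2 * d / 4 - t * ρ`.
  set f : Cube d → ℝ := fun x => A.inf' hA fun a => (hammingDist x a : ℝ) with hf
  have hbd : ∀ x i b, f x ≤ f (Function.update x i b) + 1 := by
    intro x i b
    obtain ⟨a, ha, hae⟩ := Finset.exists_mem_eq_inf' hA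
      fun a => (hammingDist (Function.update x i b) a : ℝ)
    have h1 : f x ≤ hammingDist x a := Finset.inf'_le _ ha
    have h2 : f (Function.update x i b) = hammingDist (Function.update x i b) a := hae
    have h3 := (hammingDist_triangle x (Function.update x i b) a).trans
      (Nat.add_le_add_right (hammingDist_update_le x i b) _)
    have h4 : (hammingDist x a : ℝ) ≤ 1 + hammingDist (Function.update x i b) a := by
      exact_mod_cast h3
    linarith
  have hfA : ∀ a ∈ A, f a ≤ 0 := by
    intro a ha
    have : f a ≤ hammingDist a a := Finset.inf'_le _ ha
    simpa using this
  have hfB : ∀ b ∈ B, ρ ≤ f b := fun b hb => Finset.le_inf' hA _ fun a ha => h a ha b hb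
  set t : ℝ := 2 * ρ / d with ht
  have ht0 : 0 ≤ t := by positivity
  set μ : ℝ := (∑ x, f x) / 2 ^ d with hμ
  have hA' : (A.card : ℝ) ≤ 2 ^ d * Real.exp (-t * μ + t ^ 2 * d / 8) := by
    have h1 := sum_exp_mul_le_of_boundedDiff (-t) d f hbd
    rw [neg_sq] at h1
    refine le_trans ?_ h1
    calc (A.card : ℝ) = ∑ a ∈ A, (1 : ℝ) := by simp
      _ ≤ ∑ a ∈ A, Real.exp (-t * f a) := by
          refine Finset.sum_le_sum fun a ha => Real.one_le_exp ?_
          nlinarith [hfA a ha]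
      _ ≤ _ := Finset.sum_le_univ_sum_of_nonneg fun _ => (Real.exp_pos _).le
  have hB' : (B.card : ℝ) * Real.exp (t * ρ) ≤ 2 ^ d * Real.exp (t * μ + t ^ 2 * d / 8) := by
    have h1 := sum_exp_mul_le_of_boundedDiff t d f hbd
    refine le_trans ?_ h1
    calc (B.card : ℝ) * Real.exp (t * ρ) = ∑ b ∈ B, Real.exp (t * ρ) := by simp
      _ ≤ ∑ b ∈ B, Real.exp (t * f b) := by
          refine Finset.sum_le_sum fun b hb => Real.exp_le_exp.2 ?_
          exact mul_le_mul_of_nonneg_left (hfB b hb) ht0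
      _ ≤ _ := Finset.sum_le_univ_sum_of_nonneg fun _ => (Real.exp_pos _).le
  have hexp : t ^ 2 * d / 4 - t * ρ = -(ρ ^ 2 / d) := by
    rw [ht]
    rcases eq_or_ne (d : ℝ) 0 with h0 | h0
    · rw [h0]; simp
    · field_simp; ring
  calc (A.card : ℝ) * B.card = (A.card : ℝ) * (B.card * Real.exp (t * ρ)) * Real.exp (-(t * ρ)) := by
        have : Real.exp (t * ρ) * Real.exp (-(t * ρ)) = 1 := by rw [← Real.exp_add]; simp
        linear_combination -(A.card : ℝ) * B.card * this
    _ ≤ (2 ^ d * Real.exp (-t * μ + t ^ 2 * d / 8)) * (2 ^ d * Real.exp (t * μ + t ^ 2 * d / 8)) *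
        Real.exp (-(t * ρ)) := by gcongr
    _ = (2 * 2) ^ d * (Real.exp (-t * μ + t ^ 2 * d / 8) * Real.exp (t * μ + t ^ 2 * d / 8) *
        Real.exp (-(t * ρ))) := by rw [mul_pow]; ring
    _ = _ := by
        rw [← Real.exp_add, ← Real.exp_add, ← hexp]
        norm_num
        ring

/-! ### Ball sizes and restriction to subcubes -/

theorem sum_half_pow_hammingDist {d : ℕ} (p : Cube d) :
    ∑ x : Cube d, (1 / 2 : ℝ) ^ hammingDist x p = (3 / 2) ^ d := by
  have h1 : ∀ x : Cube d, (1 / 2 : ℝ) ^ hammingDist x p = ∏ i, if x i ≠ p i then (1 / 2 : ℝ) else 1 := by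
    intro x
    rw [Finset.prod_ite, Finset.prod_const, Finset.prod_const_one, mul_one]
    rfl
  have h2 := Finset.prod_univ_sum (fun _ : Fin d => (Finset.univ : Finset Bool))
    (fun i b => if b ≠ p i then (1 / 2 : ℝ) else 1)
  rw [Fintype.piFinset_univ] at h2
  simp_rw [h1]
  rw [← h2]
  have h3 : ∀ i, ∑ b : Bool, (if b ≠ p i then (1 / 2 : ℝ) else 1) = 3 / 2 := by
    intro i
    cases p i <;> norm_num
  rw [Finset.prod_congr rfl fun i _ => h3 i]
  simp [div_pow]

/-- Weight each point by `(1 / 2) ^ distance`: the total is `(3 / 2) ^ d`, and points of the ball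
weigh at least `2 ^ (-R)`. -/
theorem ballSize_le (R : ℝ) (d : ℕ) : (ballSize R d : ℝ) ≤ 2 ^ R * (3 / 2) ^ d := by
  rw [← sum_half_pow_hammingDist (fun _ : Fin d => false), Finset.mul_sum]
  unfold ballSize hammingBall
  rw [Finset.card_filter, Nat.cast_sum]
  refine Finset.sum_le_sum fun x _ => ?_
  split_ifs with h
  · rw [Nat.cast_one, one_div, ← Real.rpow_natCast, Real.inv_rpow (by norm_num),
      ← Real.rpow_neg (by norm_num), ← Real.rpow_add (by norm_num)]
    exact Real.one_le_rpow (by norm_num) (by linarith)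
  · push_cast
    positivity

theorem card_hammingBall {d : ℕ} (p : Cube d) (R : ℝ) : (hammingBall p R).card = ballSize R d := by
  unfold ballSize
  refine Finset.card_nbij' (fun x i => xor (x i) (p i)) (fun x i => xor (x i) (p i)) ?_ ?_ ?_ ?_
  · intro x hx
    have : hammingDist (fun i => xor (x i) (p i)) (fun _ => false) = hammingDist x p := by
      unfold hammingDist; congr 1; ext i; simp
    simpa [hammingBall, this] using hx
  · intro x hx
    have : hammingDist (fun i => xor (x i) (p i)) p = hammingDist x (fun _ => false) := by
      unfold hammingDist; congr 1; ext i
      rcases hx : x i with _ | _ <;> rcases hp : p i with _ | _ <;> simp [hx, hp]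
    simpa [hammingBall, this] using hx
  · intro x _; funext i; simp
  · intro x _; funext i; simp

/-- Padding with zeros. -/
def padCube {d' d : ℕ} (x : Cube d') : Cube d :=
  fun i => if h : (i : ℕ) < d' then x ⟨i, h⟩ else false

theorem hammingDist_padCube {d' d : ℕ} (hd : d' ≤ d) (x y : Cube d') :
    hammingDist (padCube x : Cube d) (padCube y) = hammingDist x y := by
  unfold hammingDist
  rw [← Finset.card_map (Fin.castLEEmb hd)]
  congr 1
  ext i
  rw [Finset.mem_filter, Finset.mem_map]
  simp only [Finset.mem_filter, Finset.mem_univ, true_and, Fin.castLEEmb_apply, ne_eq, padCube]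
  constructor
  · intro h
    by_cases hi : (i : ℕ) < d'
    · exact ⟨⟨i, hi⟩, by simpa [hi] using h, by ext; simp⟩
    · simp [hi] at h
  · rintro ⟨j, hj, rfl⟩
    simpa using hj

theorem padCube_injective {d' d : ℕ} (hd : d' ≤ d) :
    Function.Injective (padCube : Cube d' → Cube d) := by
  intro x y h
  have := hammingDist_padCube hd x y
  rw [h, hammingDist_self] at this
  exact hammingDist_eq_zero.1 this.symm

/-- A filter for a cube restricts to a filter for a smaller cube. -/
theorem RandFilter.HasPointwiseError.restrict {d' d s n : ℕ} {r c ε : ℝ} (hd : d' ≤ d)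
    {F : RandFilter d s} (hF : F.HasPointwiseError n r c ε) :
    ∃ F' : RandFilter d' s, F'.HasPointwiseError n r c ε := by
  classical
  let e : Cube d' ↪ Cube d := ⟨padCube, padCube_injective hd⟩
  have he : ∀ x y, hammingDist (e x) (e y) = hammingDist x y := hammingDist_padCube hd
  let res : DetFilter d s → DetFilter d' s := fun f =>
    { store := fun S => f.store (S.map e), query := fun mem q => f.query mem (e q) }
  refine ⟨F.map res, fun S hS => ?_⟩
  obtain ⟨h1, h2⟩ := hF (S.map e) (by rw [Finset.card_map, hS])
  refine ⟨?_, ?_⟩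
  · rintro q ⟨p, hp, hpq⟩ f hf
    obtain ⟨g, hg, rfl⟩ := (PMF.mem_support_map_iff _ _ _).1 hf
    exact h1 (e q) ⟨e p, Finset.mem_map_of_mem _ hp, by rwa [he]⟩ g hg
  · intro q hq
    rw [PMF.toOuterMeasure_map_apply]
    refine h2 (e q) ?_
    intro p hp
    obtain ⟨p', hp', rfl⟩ := Finset.mem_map.1 hp
    rw [he]
    exact hq p' hp'

/-! ### Counting the sets that a memory content can represent -/

theorem descFactorial_mul_pow_le {a b : ℕ} (h : a ≤ b) (n : ℕ) :
    a.descFactorial n * b ^ n ≤ b.descFactorial n * a ^ n := by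
  induction n with
  | zero => simp
  | succ n ih =>
    rw [Nat.descFactorial_succ, Nat.descFactorial_succ, pow_succ, pow_succ]
    have h1 : (a - n) * b ≤ (b - n) * a := by
      rw [Nat.sub_mul, Nat.sub_mul, mul_comm b a]
      exact Nat.sub_le_sub_left (Nat.mul_le_mul_left n h) _
    calc (a - n) * a.descFactorial n * (b ^ n * b) = (a - n) * b * (a.descFactorial n * b ^ n) := by
          ring
      _ ≤ (b - n) * a * (b.descFactorial n * a ^ n) := Nat.mul_le_mul h1 ih
      _ = _ := by ring

theorem choose_le_pow_mul_choose {a b n : ℕ} {ξ : ℝ} (h : a ≤ b) (hb : 0 < b)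
    (hξ : (a : ℝ) ≤ ξ * b) : (a.choose n : ℝ) ≤ ξ ^ n * b.choose n := by
  have h1 := descFactorial_mul_pow_le h n
  rw [Nat.descFactorial_eq_factorial_mul_choose, Nat.descFactorial_eq_factorial_mul_choose,
    mul_assoc, mul_assoc] at h1
  have h2 := Nat.le_of_mul_le_mul_left h1 (Nat.factorial_pos n)
  have h3 : (a.choose n : ℝ) * b ^ n ≤ b.choose n * a ^ n := by exact_mod_cast h2
  have hb' : (0 : ℝ) < b ^ n := by positivity
  have h4 : (a : ℝ) ^ n ≤ (ξ * b) ^ n := by gcongr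
  rw [mul_pow] at h4
  refine le_of_mul_le_mul_right ?_ hb'
  calc (a.choose n : ℝ) * b ^ n ≤ b.choose n * a ^ n := h3
    _ ≤ b.choose n * (ξ ^ n * b ^ n) := by gcongr
    _ = _ := by ring

instance instFiniteDetFilter (d s : ℕ) : Finite (DetFilter d s) :=
  Finite.of_injective
    (fun f : DetFilter d s => (f.store, f.query)) (by
      rintro ⟨a, b⟩ ⟨a', b'⟩ h
      simpa using h)

/-- The points to which the filter `f` answers 'Yes' when it stores `S`. -/
def DetFilter.yesSet {d s : ℕ} (f : DetFilter d s) (S : Finset (Cube d)) : Finset (Cube d) :=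
  Finset.univ.filter fun q => f.query (f.store S) q = true

theorem PMF.sum_toReal_eq_one {α : Type*} [Fintype α] (p : PMF α) : ∑ a, (p a).toReal = 1 := by
  rw [← ENNReal.toReal_sum fun a _ => p.apply_ne_top a, ← tsum_fintype (L := .unconditional α),
    p.tsum_coe, ENNReal.toReal_one]

theorem sum_yes_le_of_far {d s n : ℕ} {r c ε : ℝ} [Fintype (DetFilter d s)]
    {F : RandFilter d s} (hF : F.HasPointwiseError n r c ε) {S : Finset (Cube d)}
    (hS : S.card = n) {q : Cube d} (hq : q ∈ Qfar S r c) :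
    ∑ f : DetFilter d s, (F f).toReal * (if f.query (f.store S) q = true then 1 else 0) ≤ ε := by
  classical
  have h1 := (hF S hS).2 q hq
  rw [PMF.toOuterMeasure_apply_fintype] at h1
  have h2 : ∑ f : DetFilter d s, Set.indicator {f | f.query (f.store S) q = false} (⇑F) f ≠ ⊤ := by
    refine (ENNReal.sum_lt_top.2 fun f _ => ?_).ne
    refine lt_of_le_of_lt (Set.indicator_le_self _ _ _) (F.apply_lt_top f)
  have h3 := (ENNReal.ofReal_le_iff_le_toReal h2).1 h1
  rw [ENNReal.toReal_sum fun f _ => ne_top_of_le_ne_top (F.apply_ne_top f)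
    (Set.indicator_le_self _ _ _)] at h3
  have h4 : ∑ f : DetFilter d s, (F f).toReal *
      (if f.query (f.store S) q = true then 1 else 0) +
      ∑ f : DetFilter d s, (Set.indicator {f | f.query (f.store S) q = false} (⇑F) f).toReal =
      1 := by
    rw [← Finset.sum_add_distrib]
    refine Eq.trans ?_ (PMF.sum_toReal_eq_one F)
    refine Finset.sum_congr rfl fun f _ => ?_
    cases hfq : f.query (f.store S) q <;> simp [Set.indicator, hfq]
  linarith

theorem sum_card_yesSet_le {d s n : ℕ} {r c ε : ℝ} [Fintype (DetFilter d s)]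
    {F : RandFilter d s} (hF : F.HasPointwiseError n r c ε) (hε : 0 ≤ ε)
    (hB : (n : ℝ) * ballSize (c * r) d / 2 ^ d ≤ ε) {S : Finset (Cube d)} (hS : S.card = n) :
    ∑ f : DetFilter d s, (F f).toReal * (f.yesSet S).card ≤ 2 * ε * 2 ^ d := by
  classical
  set N : Finset (Cube d) := S.biUnion fun p => hammingBall p (c * r) with hN
  have hNc : (N.card : ℝ) ≤ ε * 2 ^ d := by
    have h1 : N.card ≤ n * ballSize (c * r) d := by
      refine Finset.card_biUnion_le.trans ?_
      simp [card_hammingBall, hS]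
    have h2 : (N.card : ℝ) ≤ n * ballSize (c * r) d := by exact_mod_cast h1
    rw [div_le_iff₀ (by positivity)] at hB
    exact h2.trans hB
  have hfar : ∀ q, q ∉ N → q ∈ Qfar S r c := by
    intro q hq p hp
    by_contra h
    exact hq (Finset.mem_biUnion.2 ⟨p, hp, by simpa [hammingBall] using h⟩)
  have hq : ∀ q : Cube d, ∑ f : DetFilter d s, (F f).toReal *
      (if f.query (f.store S) q = true then 1 else 0) ≤ ε + if q ∈ N then 1 else 0 := by
    intro q
    split_ifs with h
    · calc _ ≤ ∑ f : DetFilter d s, (F f).toReal := by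
            refine Finset.sum_le_sum fun f _ => ?_
            split_ifs <;> simp
        _ ≤ _ := by rw [PMF.sum_toReal_eq_one F]; linarith
    · rw [add_zero]
      exact sum_yes_le_of_far hF hS (hfar q h)
  calc ∑ f : DetFilter d s, (F f).toReal * (f.yesSet S).card
      = ∑ q : Cube d, ∑ f : DetFilter d s, (F f).toReal *
          (if f.query (f.store S) q = true then 1 else 0) := by
        rw [Finset.sum_comm]
        refine Finset.sum_congr rfl fun f _ => ?_
        rw [← Finset.mul_sum]
        simp [DetFilter.yesSet]
    _ ≤ ∑ q : Cube d, (ε + if q ∈ N then 1 else 0) := Finset.sum_le_sum fun q _ => hq q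
    _ = ε * 2 ^ d + N.card := by
        rw [Finset.sum_add_distrib]
        simp [mul_comm]
    _ ≤ _ := by linarith

/-- Some outcome of the random choices has few false positives for most sets. -/
theorem exists_detFilter {d s n : ℕ} {r c ε T : ℝ} {F : RandFilter d s}
    (hF : F.HasPointwiseError n r c ε) (hT : 0 < T) (hT2 : 2 * ε ≤ T ^ 2) (hε : 0 ≤ ε)
    (hB : (n : ℝ) * ballSize (c * r) d / 2 ^ d ≤ ε) :
    ∃ f ∈ F.support, (((Finset.univ.powersetCard n).filter fun S : Finset (Cube d) =>
      T * 2 ^ d < (f.yesSet S).card).card : ℝ) ≤ T * (2 ^ d).choose n := by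
  classical
  have : Fintype (DetFilter d s) := Fintype.ofFinite _
  set P : Finset (Finset (Cube d)) := Finset.univ.powersetCard n with hP
  have hPc : P.card = (2 ^ d).choose n := by simp [hP, Finset.card_powersetCard]
  -- Markov's inequality for each `S`, using `2 * ε ≤ T ^ 2`; averaging over `S` then yields one
  -- good outcome. It is sought in the support because only there false negatives are excluded.
  have h1 : ∀ S ∈ P, ∑ f : DetFilter d s, (F f).toReal *
      (if T * 2 ^ d < (f.yesSet S).card then 1 else 0) ≤ T := by
    intro S hS
    have h2 := sum_card_yesSet_le hF hε hB (Finset.mem_powersetCard.1 hS).2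
    have hTd : 0 < T * 2 ^ d := by positivity
    refine le_of_mul_le_mul_right ?_ hTd
    rw [Finset.sum_mul]
    calc _ ≤ ∑ f : DetFilter d s, (F f).toReal * (f.yesSet S).card := by
          refine Finset.sum_le_sum fun f _ => ?_
          rw [mul_assoc]
          gcongr
          split_ifs with h
          · linarith
          · simp
      _ ≤ 2 * ε * 2 ^ d := h2
      _ ≤ T ^ 2 * 2 ^ d := by gcongr
      _ = T * (T * 2 ^ d) := by ring
  by_contra hcon
  push Not at hcon
  have h3 : ∑ f : DetFilter d s, (F f).toReal * (T * P.card) <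
      ∑ f : DetFilter d s, (F f).toReal *
        ((P.filter fun S : Finset (Cube d) => T * 2 ^ d < (f.yesSet S).card).card : ℝ) := by
    obtain ⟨f₀, hf₀⟩ := F.support_nonempty
    refine Finset.sum_lt_sum (fun f _ => ?_) ⟨f₀, Finset.mem_univ _, ?_⟩
    · by_cases hf : f ∈ F.support
      · have := hcon f hf
        rw [hPc]
        gcongr
      · rw [PMF.mem_support_iff, not_not] at hf
        simp [hf]
    · have := hcon f₀ hf₀
      rw [hPc]
      have hpos : 0 < (F f₀).toReal :=
        ENNReal.toReal_pos ((PMF.mem_support_iff _ _).1 hf₀) (F.apply_ne_top _)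
      gcongr
  rw [← Finset.sum_mul, PMF.sum_toReal_eq_one, one_mul] at h3
  have h4 : ∑ f : DetFilter d s, (F f).toReal *
        ((P.filter fun S : Finset (Cube d) => T * 2 ^ d < (f.yesSet S).card).card : ℝ) ≤
      T * P.card := by
    calc _ = ∑ S ∈ P, ∑ f : DetFilter d s, (F f).toReal *
          (if T * 2 ^ d < (f.yesSet S).card then 1 else 0) := by
          rw [Finset.sum_comm]
          refine Finset.sum_congr rfl fun f _ => ?_
          rw [← Finset.mul_sum, Finset.card_filter]
          push_cast
          rfl
      _ ≤ ∑ S ∈ P, T := Finset.sum_le_sum h1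
      _ = _ := by simp [mul_comm]
  linarith

/-- Each memory content represents few sets, as their points are well inside of its 'Yes' set. -/
theorem one_sub_le_two_pow_mul_pow {d s n : ℕ} {r c ε T ξ : ℝ} {F : RandFilter d s}
    (hF : F.HasPointwiseError n r c ε) (hn : n ≤ 2 ^ d) (hT : 0 < T) (hT2 : 2 * ε ≤ T ^ 2)
    (hε : 0 ≤ ε) (hB : (n : ℝ) * ballSize (c * r) d / 2 ^ d ≤ ε)
    (hξ : ∀ Y I : Finset (Cube d), (Y.card : ℝ) ≤ T * 2 ^ d →
      (∀ x ∈ I, ∀ q, (hammingDist q x : ℝ) ≤ r → q ∈ Y) → (I.card : ℝ) ≤ ξ * 2 ^ d)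
    (hξ0 : 0 ≤ ξ) : 1 - T ≤ 2 ^ s * ξ ^ n := by
  classical
  obtain ⟨f, hf, hbad⟩ := exists_detFilter hF hT hT2 hε hB
  set P : Finset (Finset (Cube d)) := Finset.univ.powersetCard n with hP
  have hPc : P.card = (2 ^ d).choose n := by simp [hP, Finset.card_powersetCard]
  set G := P.filter fun S => ¬ T * 2 ^ d < (f.yesSet S).card with hG
  have hGc : (1 - T) * (2 ^ d).choose n ≤ (G.card : ℝ) := by
    have := Finset.card_filter_add_card_filter_not (s := P)
      (fun S => T * 2 ^ d < ((f.yesSet S).card : ℝ))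
    rw [hPc, ← hG] at this
    have h2 : ((P.filter fun S => T * 2 ^ d < ((f.yesSet S).card : ℝ)).card : ℝ) + G.card =
      (2 ^ d).choose n := by exact_mod_cast this
    linarith
  have hfib : ∀ σ : Fin s → Bool, ((G.filter fun S => f.store S = σ).card : ℝ) ≤
      ξ ^ n * (2 ^ d).choose n := by
    intro σ
    set Y : Finset (Cube d) := Finset.univ.filter fun q => f.query σ q = true with hY
    set I : Finset (Cube d) :=
      Finset.univ.filter fun x => ∀ q, (hammingDist q x : ℝ) ≤ r → q ∈ Y with hI
    -- One good set stored as `σ` bounds `Y`, which depends on `σ` alone.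
    rcases (G.filter fun S => f.store S = σ).eq_empty_or_nonempty with he | ⟨S₀, hS₀⟩
    · rw [he]; simp; positivity
    have hYc : (Y.card : ℝ) ≤ T * 2 ^ d := by
      obtain ⟨h1, h2⟩ := Finset.mem_filter.1 hS₀
      have h3 := not_lt.1 (Finset.mem_filter.1 h1).2
      rw [DetFilter.yesSet, h2] at h3
      exact h3
    have hIc : (I.card : ℝ) ≤ ξ * ((2 ^ d : ℕ) : ℝ) := by
      push_cast
      exact hξ Y I hYc fun x hx => (Finset.mem_filter.1 hx).2
    have hsub : (G.filter fun S => f.store S = σ) ⊆ I.powersetCard n := by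
      intro S hS
      obtain ⟨h1, h2⟩ := Finset.mem_filter.1 hS
      have hSn := (Finset.mem_powersetCard.1 (Finset.mem_filter.1 h1).1).2
      refine Finset.mem_powersetCard.2 ⟨fun x hx => ?_, hSn⟩
      refine Finset.mem_filter.2 ⟨Finset.mem_univ _, fun q hq => ?_⟩
      refine Finset.mem_filter.2 ⟨Finset.mem_univ _, ?_⟩
      rw [← h2]
      exact (hF S hSn).1 q ⟨x, hx, hq⟩ f hf
    have hI2 : I.card ≤ 2 ^ d := by
      have := Finset.card_le_univ I
      simpa using this
    calc ((G.filter fun S => f.store S = σ).card : ℝ) ≤ (I.card.choose n : ℝ) := by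
          rw [← Finset.card_powersetCard]
          exact_mod_cast Finset.card_le_card hsub
      _ ≤ _ := choose_le_pow_mul_choose hI2 (by positivity) hIc
  have hGs : (G.card : ℝ) ≤ 2 ^ s * (ξ ^ n * (2 ^ d).choose n) := by
    rw [Finset.card_eq_sum_card_fiberwise (f := f.store) (t := Finset.univ) (fun _ _ => by simp)]
    push_cast
    calc _ ≤ ∑ _σ : Fin s → Bool, ξ ^ n * ((2 ^ d).choose n : ℝ) :=
          Finset.sum_le_sum fun σ _ => hfib σ
      _ = _ := by simp
  have hch : (0 : ℝ) < (2 ^ d).choose n := by exact_mod_cast Nat.choose_pos hn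
  refine le_of_mul_le_mul_right (hGc.trans hGs |>.trans_eq ?_) hch
  ring

theorem one_le_ballSize {R : ℝ} (hR : 0 ≤ R) (d : ℕ) : 1 ≤ ballSize R d :=
  Finset.card_pos.2 ⟨fun _ => false, by simp [hammingBall, hR]⟩

theorem natCast_le_two_pow {d n : ℕ} {R ε : ℝ} (hR : 0 ≤ R)
    (hB : (n : ℝ) * ballSize R d / 2 ^ d < ε) (hε : ε ≤ 1) :
    (n : ℝ) * ballSize R d < 2 ^ d ∧ n ≤ 2 ^ d := by
  have h1 : (n : ℝ) * ballSize R d < 2 ^ d := by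
    have := (div_lt_iff₀ (by positivity)).1 hB
    nlinarith [show (0 : ℝ) < 2 ^ d by positivity]
  refine ⟨h1, ?_⟩
  have h2 := one_le_ballSize hR d
  have h3 : n * ballSize R d < 2 ^ d := by exact_mod_cast h1
  nlinarith

/-- A memory of zero bits does not suffice. -/
theorem RandFilter.HasPointwiseError.one_le_bits {d s n : ℕ} {r c ε : ℝ} {F : RandFilter d s}
    (hF : F.HasPointwiseError n r c ε) (hn : 1 ≤ n) (hr : 0 ≤ r) (hc : 0 ≤ c)
    (hB : (n : ℝ) * ballSize (c * r) d / 2 ^ d < ε) (hε : ε < 1) : 1 ≤ s := by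
  classical
  rw [Nat.one_le_iff_ne_zero]
  rintro rfl
  obtain ⟨h1, h2⟩ := natCast_le_two_pow (mul_nonneg hc hr) hB hε.le
  obtain ⟨S, -, hS⟩ := Finset.exists_subset_card_eq
    (s := (Finset.univ : Finset (Cube d))) (n := n) (by simpa using h2)
  obtain ⟨q, hq⟩ : ∃ q, q ∉ S.biUnion fun p => hammingBall p (c * r) := by
    by_contra hcon
    push Not at hcon
    have h3 : 2 ^ d ≤ n * ballSize (c * r) d := by
      calc 2 ^ d = (Finset.univ : Finset (Cube d)).card := by simp
        _ ≤ (S.biUnion fun p => hammingBall p (c * r)).card :=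
          Finset.card_le_card fun q _ => hcon q
        _ ≤ _ := by
          refine Finset.card_biUnion_le.trans ?_
          simp [card_hammingBall, hS]
    have h4 : (2 : ℝ) ^ d ≤ n * ballSize (c * r) d := by exact_mod_cast h3
    linarith
  have hfar : q ∈ Qfar S r c := by
    intro p hp
    by_contra h
    exact hq (Finset.mem_biUnion.2 ⟨p, hp, by simpa [hammingBall] using h⟩)
  have hprob := (hF S hS).2 q hfar
  -- Some outcome rejects `q` for `S`; with no memory it also rejects `q` for a set containing `q`.
  have hpos : F.toOuterMeasure {f | f.query (f.store S) q = false} ≠ 0 := by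
    intro h0
    rw [h0, nonpos_iff_eq_zero, ENNReal.ofReal_eq_zero] at hprob
    linarith
  rw [Ne, PMF.toOuterMeasure_apply_eq_zero_iff, Set.not_disjoint_iff] at hpos
  obtain ⟨f, hf, hfq⟩ := hpos
  obtain ⟨S', hqS', -, hS'⟩ := Finset.exists_subsuperset_card_eq
    (s := ({q} : Finset (Cube d))) (t := Finset.univ) (n := n) (Finset.subset_univ _)
    (by simpa using hn) (by simpa using h2)
  have hyes := (hF S' hS').1 q ⟨q, hqS' (Finset.mem_singleton_self q), by simpa using hr⟩ f hf
  rw [Subsingleton.elim (f.store S') (f.store S)] at hyes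
  have hno : f.query (f.store S) q = false := hfq
  rw [hno] at hyes
  exact absurd hyes (by simp)

/-! ### The space lower bounds -/

/-- Taking logarithms leaves an additive `2`, absorbed by `s ≥ 1`. -/
theorem mul_neg_logb_le_of_le_two_pow_mul_pow {s n : ℕ} {T ξ : ℝ} (hs : 1 ≤ s) (hξ : 0 < ξ)
    (hT : T ≤ 3 / 4) (h : 1 - T ≤ 2 ^ s * ξ ^ n) : n * -Real.logb 2 ξ ≤ 3 * s := by
  have h1 : (1 / 4 : ℝ) ≤ 2 ^ s * ξ ^ n := by linarith
  have h2 := Real.logb_le_logb_of_le (b := 2) (by norm_num) (by norm_num) h1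
  rw [Real.logb_mul (by positivity) (by positivity), Real.logb_pow, Real.logb_pow,
    Real.logb_self_eq_one (by norm_num)] at h2
  have h3 : Real.logb 2 (1 / 4) = -2 := by
    have : (1 / 4 : ℝ) = 2 ^ (-2 : ℝ) := by rw [Real.rpow_neg (by norm_num)]; norm_num
    rw [this, Real.logb_rpow (by norm_num) (by norm_num)]
  have h4 : (1 : ℝ) ≤ s := by exact_mod_cast hs
  linarith

/-- The space lower bounds in terms of the error and of the dimension. -/
theorem RandFilter.HasPointwiseError.le_bits {d s n : ℕ} {r c ε : ℝ} {F : RandFilter d s}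
    (hF : F.HasPointwiseError n r c ε) (hn : 1 ≤ n) (hr : 0 ≤ r) (hc : 0 ≤ c)
    (hB : (n : ℝ) * ballSize (c * r) d / 2 ^ d < ε) (hε : ε < 1 / 4) :
    n * Real.logb 2 (1 / ε) ≤ 12 * s ∧ n * r ^ 2 ≤ 15 * s * d := by
  classical
  have hε0 : 0 < ε := lt_of_le_of_lt (by positivity) hB
  have hs := hF.one_le_bits hn hr hc hB (by linarith)
  have hn2 := (natCast_le_two_pow (mul_nonneg hc hr) hB (by linarith)).2
  set T := Real.sqrt (2 * ε) with hTdef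
  have hT : 0 < T := Real.sqrt_pos.2 (by positivity)
  have hT2 : T ^ 2 = 2 * ε := Real.sq_sqrt (by positivity)
  have hT34 : T ≤ 3 / 4 := by
    rw [hTdef, Real.sqrt_le_left (by norm_num)]; linarith
  have hYI : ∀ Y I : Finset (Cube d),
      (∀ x ∈ I, ∀ q, (hammingDist q x : ℝ) ≤ r → q ∈ Y) → I ⊆ Y :=
    fun Y I h x hx => h x hx x (by simpa using hr)
  have hlogT : Real.logb 2 (1 / ε) ≤ 4 * -Real.logb 2 T ∧ 2 ≤ Real.logb 2 (1 / ε) := by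
    have e1 : Real.logb 2 (1 / ε) = -Real.logb 2 ε := by rw [one_div, Real.logb_inv]
    have e2 : 2 * Real.logb 2 T = 1 + Real.logb 2 ε := by
      have : Real.logb 2 (T ^ 2) = Real.logb 2 (2 * ε) := by rw [hT2]
      rw [Real.logb_pow, Real.logb_mul (by norm_num) hε0.ne', Real.logb_self_eq_one (by norm_num)]
        at this
      exact_mod_cast this
    have e3 : Real.logb 2 ε ≤ -2 := by
      rw [Real.logb_le_iff_le_rpow (by norm_num) hε0, Real.rpow_neg (by norm_num)]
      norm_num
      linarith
    constructor <;> linarith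
  have hX1 := mul_neg_logb_le_of_le_two_pow_mul_pow hs hT hT34
    (one_sub_le_two_pow_mul_pow hF hn2 hT hT2.ge hε0.le hB.le
      (fun Y I hY hI => (Nat.cast_le.2 (Finset.card_le_card (hYI Y I hI))).trans hY) hT.le)
  -- The complement of `Y` has density at least `1 / 4` and is farther than `r` from `I`.
  set ξ := 4 * Real.exp (-(r ^ 2 / d)) with hξdef
  have hξ : 0 < ξ := by positivity
  have hX2 := mul_neg_logb_le_of_le_two_pow_mul_pow hs hξ hT34
    (one_sub_le_two_pow_mul_pow hF hn2 hT hT2.ge hε0.le hB.le (ξ := ξ)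
      (fun Y I hY hI => by
        have h1 := card_mul_card_le_of_far Yᶜ I r hr (by
          intro a ha b hb
          by_contra hcon
          rw [hammingDist_comm] at hcon
          exact Finset.mem_compl.1 ha (hI b hb a (not_le.1 hcon).le))
        have h2 : (1 / 4 : ℝ) * 2 ^ d ≤ (Yᶜ.card : ℝ) := by
          have h3 : Y.card + Yᶜ.card = 2 ^ d := by
            rw [Finset.card_add_card_compl]; simp
          have h4 : (Y.card : ℝ) + Yᶜ.card = 2 ^ d := by exact_mod_cast h3
          nlinarith [show (0 : ℝ) < 2 ^ d by positivity]
        have h5 : (0 : ℝ) < 1 / 4 * 2 ^ d := by positivity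
        refine le_of_mul_le_mul_left ?_ h5
        calc (1 / 4 : ℝ) * 2 ^ d * I.card ≤ Yᶜ.card * I.card := by gcongr
          _ ≤ 4 ^ d * Real.exp (-(r ^ 2 / d)) := h1
          _ = _ := by
            rw [hξdef, show (4 : ℝ) = 2 * 2 by norm_num, mul_pow]
            ring) hξ.le)
  have hn0 : (0 : ℝ) < n := by exact_mod_cast hn
  have hfirst : n * Real.logb 2 (1 / ε) ≤ 12 * s := by
    have := mul_le_mul_of_nonneg_left hlogT.1 hn0.le
    linarith
  refine ⟨hfirst, ?_⟩
  rcases Nat.eq_zero_or_pos d with rfl | hd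
  · have h1 : (1 : ℝ) ≤ n * ballSize (c * r) 0 := by
      have h2 := one_le_ballSize (mul_nonneg hc hr) 0
      exact_mod_cast Nat.mul_le_mul hn h2
    rw [pow_zero, div_one] at hB
    linarith
  have hd0 : (0 : ℝ) < d := by exact_mod_cast hd
  set X := r ^ 2 / d with hX
  have hX0 : 0 ≤ X := by positivity
  have hlogξ : X - 2 ≤ -Real.logb 2 ξ := by
    have e1 : Real.logb 2 ξ = 2 + -X / Real.log 2 := by
      rw [hξdef, Real.logb_mul (by norm_num) (Real.exp_pos _).ne']
      have : Real.logb 2 4 = 2 := by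
        rw [show (4 : ℝ) = 2 ^ (2 : ℝ) by norm_num, Real.logb_rpow (by norm_num) (by norm_num)]
      rw [this, Real.logb, Real.log_exp]
    have h2 : X ≤ X / Real.log 2 := by
      rw [le_div_iff₀ (Real.log_pos (by norm_num))]
      nlinarith [Real.log_two_lt_d9]
    rw [e1, neg_div]
    linarith
  -- The loss `2 * n` is at most `n * log (1 / ε) ≤ 12 * s`, as `ε < 1 / 4`.
  have hfin : n * X ≤ 15 * s := by
    have h1 := mul_le_mul_of_nonneg_left hlogξ hn0.le
    have h2 := mul_le_mul_of_nonneg_left hlogT.2 hn0.le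
    nlinarith
  calc n * r ^ 2 = n * X * d := by rw [hX]; field_simp
    _ ≤ _ := by gcongr

/-- The bound in terms of `r / c`, by restriction to a cube of dimension `O(c * r)`. -/
theorem RandFilter.HasPointwiseError.div_le_bits {d s n : ℕ} {r c ε : ℝ} {F : RandFilter d s}
    (hF : F.HasPointwiseError n r c ε) (hn : 1 ≤ n) (hr : 0 ≤ r) (hc : 2 ≤ c)
    (hB : (n : ℝ) * ballSize (c * r) d / 2 ^ d < ε) (hε : ε < 1 / 4)
    (hL : Real.logb 2 (n / ε) ≤ c * r) : n * (r / c) ≤ 105 * s := by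
  have hε0 : 0 < ε := lt_of_le_of_lt (by positivity) hB
  have hn0 : (0 : ℝ) < n := by exact_mod_cast hn
  have hn1 : (1 : ℝ) ≤ n := by exact_mod_cast hn
  set L := Real.logb 2 (n / ε) with hLdef
  have hL2 : 2 ≤ L := by
    rw [hLdef, Real.le_logb_iff_rpow_le (by norm_num) (by positivity), le_div_iff₀ hε0]
    norm_num
    linarith
  have hr0 : 0 < r := by
    by_contra h
    have : r = 0 := le_antisymm (not_lt.1 h) hr
    rw [this, mul_zero] at hL
    linarith
  -- The smaller cube must still satisfy the volume condition: the ball bound leaves `n * 2 ^ (c *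
  -- r) * (3 / 4) ^ d₀`, and `(3 / 4) ^ 3 < 1 / 2`.
  set d₀ := ⌈3 * (c * r + L)⌉₊ with hd₀
  have hd1 : 3 * (c * r + L) ≤ d₀ := Nat.le_ceil _
  have hd2 : (d₀ : ℝ) ≤ 7 * (c * r) := by
    have := (Nat.ceil_lt_add_one (show 0 ≤ 3 * (c * r + L) by linarith)).le
    rw [← hd₀] at this
    linarith
  have hB0 : (n : ℝ) * ballSize (c * r) d₀ / 2 ^ d₀ < ε := by
    have h1 := ballSize_le (c * r) d₀
    have h2 : (3 / 4 : ℝ) ^ d₀ < 2 ^ (-(c * r + L)) := by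
      have e1 : (3 / 4 : ℝ) ^ d₀ ≤ (3 / 4 : ℝ) ^ (3 * (c * r + L)) := by
        rw [← Real.rpow_natCast]
        exact Real.rpow_le_rpow_of_exponent_ge (by norm_num) (by norm_num) hd1
      refine e1.trans_lt ?_
      rw [Real.rpow_mul (by norm_num), Real.rpow_neg (by norm_num), ← Real.inv_rpow (by norm_num)]
      exact Real.rpow_lt_rpow (by positivity) (by norm_num) (by linarith)
    have h3 : (2 : ℝ) ^ L = n / ε := Real.rpow_logb (by norm_num) (by norm_num) (by positivity)
    calc (n : ℝ) * ballSize (c * r) d₀ / 2 ^ d₀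
        ≤ n * (2 ^ (c * r) * (3 / 2) ^ d₀) / 2 ^ d₀ := by gcongr
      _ = n * 2 ^ (c * r) * (3 / 4) ^ d₀ := by
          rw [show (3 / 4 : ℝ) = 3 / 2 / 2 by norm_num, div_pow (3 / 2 : ℝ) 2]; ring
      _ < n * 2 ^ (c * r) * 2 ^ (-(c * r + L)) := by gcongr
      _ = n * 2 ^ (-L) := by
          rw [mul_assoc, ← Real.rpow_add (by norm_num)]; congr 2; ring
      _ = ε := by rw [Real.rpow_neg (by norm_num), h3]; field_simp
  obtain ⟨d', F', hF', hB', hd'⟩ : ∃ (d' : ℕ) (F' : RandFilter d' s),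
      F'.HasPointwiseError n r c ε ∧ (n : ℝ) * ballSize (c * r) d' / 2 ^ d' < ε ∧ d' ≤ d₀ := by
    rcases le_total d d₀ with h | h
    · exact ⟨d, F, hF, hB, h⟩
    · obtain ⟨F', hF'⟩ := hF.restrict h
      exact ⟨d₀, F', hF', hB0, le_rfl⟩
  have h1 := (hF'.le_bits hn hr (by linarith) hB' hε).2
  have h2 : (d' : ℝ) ≤ 7 * (c * r) := le_trans (by exact_mod_cast hd') hd2
  have h3 : n * r ^ 2 ≤ 15 * s * (7 * (c * r)) := h1.trans (by gcongr)
  rw [← mul_div_assoc, div_le_iff₀ (by linarith)]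
  refine le_of_mul_le_mul_right ?_ hr0
  linarith

theorem lower_bound_of_logb_le : ∃ κ : ℝ, 0 < κ ∧
    ∀ (d n : ℕ) (r c ε : ℝ), 1 ≤ n → 0 ≤ r → 2 ≤ c →
      (n : ℝ) * ballSize (c * r) d / 2 ^ d < ε → ε < 1 / 4 →
      Real.logb 2 (n / ε) ≤ r / c →
      ∀ (s : ℕ) (F : RandFilter d s), RandFilter.HasPointwiseError F n r c ε →
        κ * (n * (r / c + Real.logb 2 (n / ε))) ≤ (s : ℝ) := by
  refine ⟨1 / 210, by norm_num, fun d n r c ε hn hr hc hB hε hL s F hF => ?_⟩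
  have hrc : r / c ≤ c * r :=
    (div_le_self hr (by linarith)).trans (le_mul_of_one_le_left hr (by linarith))
  have h1 := hF.div_le_bits hn hr hc hB hε (hL.trans hrc)
  have h2 : (n : ℝ) * Real.logb 2 (n / ε) ≤ n * (r / c) := by gcongr
  linarith

/-- Once `h n > -1 / 2`, the hypothesis gives `√n ≤ 1 / ε`, so `log n ≤ 2 * log (1 / ε)`. The
finitely many smaller `n` have `log n ≤ n₀`. -/
theorem exists_logb_div_le (h : ℕ → ℝ) (hh : Tendsto h atTop (𝓝 0)) : ∃ K : ℝ, 1 ≤ K ∧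
    ∀ (n : ℕ) (ε : ℝ), 1 ≤ n → 0 < ε → ε < 1 / 4 → ε ≤ 1 / (n : ℝ) ^ (1 + h n) →
      Real.logb 2 (n / ε) ≤ K * Real.logb 2 (1 / ε) := by
  have hev : ∀ᶠ n in atTop, -(1 / 2) < h n := hh.eventually (lt_mem_nhds (by norm_num))
  obtain ⟨n₀, hn₀⟩ := eventually_atTop.1 hev
  refine ⟨3 + n₀, by linarith [Nat.cast_nonneg (α := ℝ) n₀], fun n ε hn hε hε4 hle => ?_⟩
  have hn0 : (0 : ℝ) < n := by exact_mod_cast hn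
  have hn1 : (1 : ℝ) ≤ n := by exact_mod_cast hn
  set E := Real.logb 2 (1 / ε) with hE
  have hE2 : 1 ≤ E := by
    rw [hE, Real.le_logb_iff_rpow_le (by norm_num) (by positivity), le_div_iff₀ hε]
    norm_num
    linarith
  have hN0 : 0 ≤ Real.logb 2 n := Real.logb_nonneg (by norm_num) hn1
  have hsplit : Real.logb 2 (n / ε) = Real.logb 2 n + E := by
    rw [hE, ← Real.logb_mul hn0.ne' (by positivity)]; congr 1; ring
  have hn₀0 := Nat.cast_nonneg (α := ℝ) n₀
  rw [hsplit]
  rcases le_total n₀ n with hc | hc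
  · have h1 : (n : ℝ) ^ (1 + h n) ≤ 1 / ε := by
      rw [le_div_iff₀ hε]
      rw [le_div_iff₀ (by positivity)] at hle
      linarith
    have h2 := Real.logb_le_logb_of_le (b := 2) (by norm_num) (by positivity) h1
    rw [Real.logb_rpow_eq_mul_logb_of_pos hn0] at h2
    have h3 := hn₀ n hc
    nlinarith
  · have h1 : Real.logb 2 n ≤ n₀ := by
      rw [Real.logb_le_iff_le_rpow (by norm_num) hn0, Real.rpow_natCast]
      have : n ≤ 2 ^ n₀ := hc.trans Nat.lt_two_pow_self.le
      exact_mod_cast this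
    nlinarith

theorem lower_bound_of_le_one_div_rpow (h : ℕ → ℝ) (hh : Tendsto h atTop (𝓝 0)) :
    ∃ κ : ℝ, 0 < κ ∧
      ∀ (d n : ℕ) (r c ε : ℝ), 1 ≤ n → 0 ≤ r → 2 ≤ c →
        (n : ℝ) * ballSize (c * r) d / 2 ^ d < ε → ε < 1 / 4 →
        ε ≤ 1 / (n : ℝ) ^ (1 + h n) →
        ∀ (s : ℕ) (F : RandFilter d s), RandFilter.HasPointwiseError F n r c ε →
          κ * (n * (r / c + Real.logb 2 (n / ε))) ≤ (s : ℝ) := by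
  obtain ⟨K, hK1, hK⟩ := exists_logb_div_le h hh
  refine ⟨1 / (210 * K), by positivity, fun d n r c ε hn hr hc hB hε hle s F hF => ?_⟩
  have hε0 : 0 < ε := lt_of_le_of_lt (by positivity) hB
  have hL := hK n ε hn hε0 hε hle
  have hn0 : (0 : ℝ) < n := by exact_mod_cast hn
  have hE := (hF.le_bits hn hr (by linarith) hB hε).1
  set L := Real.logb 2 (n / ε) with hLdef
  have hnL : n * L ≤ 12 * K * s := by
    have h1 := mul_le_mul_of_nonneg_left hL hn0.le
    nlinarith
  have hs0 : (0 : ℝ) ≤ s := Nat.cast_nonneg s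
  have hsK : (s : ℝ) ≤ K * s := le_mul_of_one_le_left hs0 hK1
  have key : n * (r / c + L) ≤ 210 * K * s := by
    -- If `L` exceeds `c * r`, it also exceeds `r / c`, and the bound in terms of `ε` alone is
    -- enough.
    rcases le_total L (c * r) with hcase | hcase
    · have h1 := hF.div_le_bits hn hr hc hB hε hcase
      nlinarith
    · have hrc : r / c ≤ L := by
        refine le_trans ?_ hcase
        exact (div_le_self hr (by linarith)).trans (le_mul_of_one_le_left hr (by linarith))
      have := mul_le_mul_of_nonneg_left hrc hn0.le
      nlinarith
  rw [one_div, inv_mul_le_iff₀ (by positivity)]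
  exact key

theorem theorem6 :
    -- existence of the filter and its space, with one universal constant
    (∃ C : ℝ, 0 < C ∧
      ∀ (d n : ℕ) (r c ε : ℝ), 1 ≤ n → 0 ≤ r → 1 < c → 0 < ε → ε ≤ 1 → 2 * ε ≤ (n : ℝ) →
        ∃ (s : ℕ) (F : RandFilter d s), RandFilter.HasPointwiseError F n r c ε ∧
          (s : ℝ) ≤ C * (n * (r / (c - 1) + (c / (c - 1)) ^ 2 * Real.logb 2 (n / ε))) ∧
          (2 ≤ c → (s : ℝ) ≤ C * (n * (r / c + Real.logb 2 (n / ε))))) ∧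
    -- optimality for `c ≥ 2` when `r / c ≥ log (n / ε)`
    (∃ κ : ℝ, 0 < κ ∧
      ∀ (d n : ℕ) (r c ε : ℝ), 1 ≤ n → 0 ≤ r → 2 ≤ c →
        (n : ℝ) * ballSize (c * r) d / 2 ^ d < ε → ε < 1 / 4 →
        Real.logb 2 (n / ε) ≤ r / c →
        ∀ (s : ℕ) (F : RandFilter d s), RandFilter.HasPointwiseError F n r c ε →
          κ * (n * (r / c + Real.logb 2 (n / ε))) ≤ (s : ℝ)) ∧
    -- optimality for `c ≥ 2` when `ε ≤ 1 / n ^ (1 + o(1))`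
    (∀ h : ℕ → ℝ, Tendsto h atTop (𝓝 0) → ∃ κ : ℝ, 0 < κ ∧
      ∀ (d n : ℕ) (r c ε : ℝ), 1 ≤ n → 0 ≤ r → 2 ≤ c →
        (n : ℝ) * ballSize (c * r) d / 2 ^ d < ε → ε < 1 / 4 →
        ε ≤ 1 / (n : ℝ) ^ (1 + h n) →
        ∀ (s : ℕ) (F : RandFilter d s), RandFilter.HasPointwiseError F n r c ε →
          κ * (n * (r / c + Real.logb 2 (n / ε))) ≤ (s : ℝ)) :=
  ⟨exists_filter, lower_bound_of_logb_le, lower_bound_of_le_one_div_rpow⟩
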